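/- Let $N\ge m\ge 0$ and $0\le R\le N$ be integers, $\eta\in\mathbb{C}\setminus\{0\}$, and let $\xi_1,\ldots,\xi_N\in\mathbb{C}$ satisfy $\xi_i\ne\xi_j$ and $\xi_i\neq\xi_j\pm\eta$ for all $i\neq j$. Put $a(\lambda)=\prod_{n=1}^N(\lambda-\xi_n+\eta)$, $d(\lambda)=\prod_{n=1}^N(\lambda-\xi_n)$, $\xi_n^{(h)}=\xi_n-h\eta$ for $h\in\{0,1\}$, and $V(x_1,\ldots,x_N)=\prod_{i<j}(x_j-x_i)$. On $\mathbb{C}^2\otimes(\mathbb{C}^2)^{\otimes N}$ let $T_0(\lambda)=R_{0N}(\lambda-\xi_N)\cdots R_{01}(\lambda-\xi_1)=\begin{pmatrix}A(\lambda)&B(\lambda)\\ C(\lambda)&D(\lambda)\end{pmatrix}_{[0]}$ be the monodromy matrix of the inhomogeneous XXX chain, where $R(\lambda)=\lambda\,\mathrm{Id}+\eta P$ with $P$ the permutation of $\mathbb{C}^2\otimes\mathbb{C}^2$. Let $|0\rangle$ be the tensor product of $N$ copies of the first basis vector of $\mathbb{C}^2$, let $\langle 0|$ be its dual, and for $\mathbf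 h\in\{0,1\}^N$ let $$\langle\mathbf h|=\langle 0|\prod_{n=1}^N\Big(\frac{C(\xi_n)}{d(\xi_n-\eta)}\Big)^{h_n},\qquad |\mathbf h\rangle=\frac{1}{V(\xi_1,\ldots,\xi_N)}\prod_{n=1}^N\Big(-\frac{B(\xi_n)}{a(\xi_n)}\Big)^{h_n}|0\rangle$$ be the separation-of-variables bases. For a polynomial $Q$ define the separate states $$\langle Q|=\sum_{\mathbf h}\prod_{n=1}^N Q(\xi_n^{(h_n)})\,V(\xi_1^{(h_1)},\ldots,\xi_N^{(h_N)})\,\langle\mathbf h|,\qquad |Q\rangle=\sum_{\mathbf h}\prod_{n=1}^N Q(\xi_n^{(h_n)})\,V(\xi_1^{(1-h_1)},\ldots,\xi_N^{(1-h_N)})\,|\mathbf h\rangle .$$ Let $Q_\tau(\lambda)=\prod_{j=1}^R(\lambda-q_j)$, where $q_1,\ldots,q_R$ are pairwise distinct and different from all $\xi_n$, and let $\tau$ be an entire function with $$\tau(\lambda)\,Q_\tau(\lambda)=-a(\lambda)\,Q_\tau(\lambda-\eta)+d(\lambda)\,Q_\tau(\lambda+\eta)\qquad\text{for all }\lambda\in\mathbb{C}$$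 (so that $\tau(\lambda)$ is an eigenvalue of the anti-periodic transfer matrix $B(\lambda)+C(\lambda)$, with eigenstates $\langle Q_\tau|$, $|Q_\tau\rangle$), and suppose that $\langle Q_\tau|Q_\tau\rangle\neq 0$. Let $\boldsymbol\epsilon=(\epsilon_1,\ldots,\epsilon_{2m})\in\{1,2\}^{2m}$, let $E^{\epsilon,\epsilon'}_j$ be the elementary matrix $(E^{\epsilon,\epsilon'})_{k,l}=\delta_{k,\epsilon}\delta_{l,\epsilon'}$ acting on the site $j$, and let $$F_m(\tau,\boldsymbol\epsilon)=\frac{\langle Q_\tau|\prod_{j=1}^m E_j^{\epsilon_{2j-1},\epsilon_{2j}}|Q_\tau\rangle}{\langle Q_\tau|Q_\tau\rangle},\quad \alpha^-_{\boldsymbol\epsilon}=\{j\le m:\epsilon_{2j-1}=1\},\quad \alpha^+_{\boldsymbol\epsilon}=\{j\le m:\epsilon_{2j}=2\}.$$ Set $q_{R+j}=\xi_j$ for $1\le j\le m$. Then $$F_m(\tau,\boldsymbol\epsilon)=\prod_{k=1}^m\frac1{\tau(\xi_k)}\sum_{\substack{\bar\alpha^-\subset\alpha^-_{\boldsymbol\epsilon}\\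 \bar\alpha^+\subset\alpha^+_{\boldsymbol\epsilon}}}(-1)^{(m-\#\bar\alpha^-+\#\bar\alpha^+)N}\,(-1)^{\#\alpha^-_{\boldsymbol\epsilon}-\#\bar\alpha^-}\sum_{\{a_j,a'_j\}}\ \prod_{j\in\bar\alpha^-}w_j\ \prod_{j\in\bar\alpha^+}w'_j\ \ \frac{\langle\bar Q_{\mathbf A_{m+1}}|Q_\tau\rangle}{\langle Q_\tau|Q_\tau\rangle},$$ where $$w_j=\frac{d(q_{a_j})\prod_{k\in\mathbf A_j,\,k\le R+j-1}(q_{a_j}-q_k+\eta)}{\prod_{k\in\mathbf A'_j,\,k\le R+j}(q_{a_j}-q_k)},\qquad w'_j=-\frac{a(q_{a'_j})\prod_{k\in\mathbf A'_j,\,k\le R+j-1}(q_k-q_{a'_j}+\eta)}{\prod_{k\in\mathbf A_{j+1},\,k\le R+j}(q_k-q_{a'_j})}.$$ Here the inner sum runs over the indices $a_j$ ($j\in\bar\alpha^-$) and $a'_j$ ($j\in\bar\alpha^+$) such that $1\le a_j\le R+j$, $a_j\in\mathbf A_j$, $1\le a'_j\le R+j$, $a'_j\in\mathbf A'_j$,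 where $$\mathbf A_j=\{b: 1\le b\le R+m,\ b\ne a_k,a'_k\ \text{for } k<j\},\qquad \mathbf A'_j=\{b:1\le b\le R+m,\ b\neq a'_k\ \text{for } k<j,\ b\ne a_k\ \text{for } k\le j\},$$ and $\bar Q_{\mathbf A_{m+1}}(\lambda)=\prod_{j\in\mathbf A_{m+1}}(\lambda-q_j)$, which is a polynomial of degree $\#\mathbf A_{m+1}=R+m-\#\bar\alpha^--\#\bar\alpha^+$. -/

import Mathlib

open Polynomial Matrix

namespace AntiperiodicXXX

noncomputable section

/-! ### The inhomogeneous XXX chain of length `N`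

The local space is `ℂ²` with basis vectors labelled by `Fin 2`; the labels `1, 2` of the usual
notation are `0, 1` here.  The quantum space `(ℂ²)^{⊗ N}` is `(Fin N → Fin 2) → ℂ`, and operators
on it are matrices indexed by `Fin N → Fin 2`. -/

/-- The rational `R`-matrix, with rows `z+η,0,0,0 | 0,z,η,0 | 0,η,z,0 | 0,0,0,z+η`. -/
def rMatrix (η z : ℂ) : Matrix (Fin 2 × Fin 2) (Fin 2 × Fin 2) ℂ :=
  Matrix.of fun p q =>
    if p = q then (if p.1 = p.2 then z + η else z)
    else if p.1 = q.2 ∧ p.2 = q.1 then η else 0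

/-- `R_{0n}(z)`: the `R`-matrix acting on the auxiliary space `0` and the site `n`, and as the
identity on the other sites. -/
def rSite {N : ℕ} (η : ℂ) (n : Fin N) (z : ℂ) :
    Matrix (Fin 2 × (Fin N → Fin 2)) (Fin 2 × (Fin N → Fin 2)) ℂ :=
  Matrix.of fun p q =>
    if ∀ k, k ≠ n → p.2 k = q.2 k then rMatrix η z (p.1, p.2 n) (q.1, q.2 n) else 0

/-- The monodromy matrix `T₀(z) = R_{0N}(z - ξ_N) ⋯ R_{01}(z - ξ_1)`. -/
def monodromy {N : ℕ} (η : ℂ) (ξ : Fin N → ℂ) (z : ℂ) :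
    Matrix (Fin 2 × (Fin N → Fin 2)) (Fin 2 × (Fin N → Fin 2)) ℂ :=
  (List.ofFn fun n : Fin N => rSite η n (z - ξ n)).reverse.prod

/-- The operator entries of the monodromy matrix in the auxiliary space. -/
def monodromyEntry {N : ℕ} (η : ℂ) (ξ : Fin N → ℂ) (i j : Fin 2) (z : ℂ) :
    Matrix (Fin N → Fin 2) (Fin N → Fin 2) ℂ :=
  Matrix.of fun s t => monodromy η ξ z (i, s) (j, t)

/-- The upper right entry `B(z)` of the monodromy matrix. -/
def opB {N : ℕ} (η : ℂ) (ξ : Fin N → ℂ) (z : ℂ) : Matrix (Fin N → Fin 2) (Fin N → Fin 2) ℂ :=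
  monodromyEntry η ξ 0 1 z

/-- The lower left entry `C(z)` of the monodromy matrix. -/
def opC {N : ℕ} (η : ℂ) (ξ : Fin N → ℂ) (z : ℂ) : Matrix (Fin N → Fin 2) (Fin N → Fin 2) ℂ :=
  monodromyEntry η ξ 1 0 z

/-- `a(z) = ∏ₙ (z - ξₙ + η)`. -/
def aFun {N : ℕ} (η : ℂ) (ξ : Fin N → ℂ) (z : ℂ) : ℂ := ∏ n, (z - ξ n + η)

/-- `d(z) = ∏ₙ (z - ξₙ)`. -/
def dFun {N : ℕ} (ξ : Fin N → ℂ) (z : ℂ) : ℂ := ∏ n, (z - ξ n)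

/-- The elementary matrix `E_n^{e₁,e₂}` acting on the site `n`. -/
def elemAt {N : ℕ} (n : Fin N) (e₁ e₂ : Fin 2) : Matrix (Fin N → Fin 2) (Fin N → Fin 2) ℂ :=
  Matrix.of fun s t => if s n = e₁ ∧ t n = e₂ ∧ ∀ k, k ≠ n → s k = t k then 1 else 0

/-! ### Separation of variables -/

/-- The Vandermonde product `V(x₁, …, x_N) = ∏_{i<j} (x_j - x_i)`. -/
def vdm {N : ℕ} (x : Fin N → ℂ) : ℂ := ∏ i, ∏ j ∈ Finset.Ioi i, (x j - x i)

/-- The shifted inhomogeneities `ξₙ^{(hₙ)} = ξₙ - hₙ η`. -/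
def shift {N : ℕ} (η : ℂ) (ξ : Fin N → ℂ) (h : Fin N → Fin 2) (n : Fin N) : ℂ :=
  ξ n - ((h n : ℕ) : ℂ) * η

/-- The left basis covector `⟨h| = ⟨0| ∏ₙ (C(ξₙ) / d(ξₙ - η))^{hₙ}` of the separated variables,
where `⟨0|` is the dual of the basis vector all of whose sites are in the first state.
It is a left eigenvector of `D(z)` with eigenvalue `∏ₙ (z - ξₙ^{(hₙ)})`. -/
def sovBra {N : ℕ} (η : ℂ) (ξ : Fin N → ℂ) (h : Fin N → Fin 2) : (Fin N → Fin 2) → ℂ :=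
  Pi.single (fun _ => 0) 1 ᵥ*
    (List.ofFn fun n : Fin N =>
      if h n = 1 then (dFun ξ (ξ n - η))⁻¹ • opC η ξ (ξ n) else 1).prod

/-- The right basis vector `|h⟩ = V(ξ)⁻¹ ∏ₙ (- B(ξₙ) / a(ξₙ))^{hₙ} |0⟩` of the separated
variables.  It is a right eigenvector of `D(z)` with eigenvalue `∏ₙ (z - ξₙ^{(hₙ)})`, and
`⟨h|k⟩ = δ_{h,k} / V(ξ₁^{(h₁)}, …, ξ_N^{(h_N)})`. -/
def sovKet {N : ℕ} (η : ℂ) (ξ : Fin N → ℂ) (h : Fin N → Fin 2) : (Fin N → Fin 2) → ℂ :=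
  (vdm ξ)⁻¹ •
    ((List.ofFn fun n : Fin N =>
      if h n = 1 then (-(aFun η ξ (ξ n))⁻¹) • opB η ξ (ξ n) else 1).prod *ᵥ
        Pi.single (fun _ => 0) 1)

/-- The left separate state
`⟨Q| = ∑_h ∏ₙ Q(ξₙ^{(hₙ)}) V(ξ₁^{(h₁)}, …, ξ_N^{(h_N)}) ⟨h|`. -/
def sepBra {N : ℕ} (η : ℂ) (ξ : Fin N → ℂ) (Q : ℂ[X]) : (Fin N → Fin 2) → ℂ :=
  ∑ h : Fin N → Fin 2,
    ((∏ n, Q.eval (shift η ξ h n)) * vdm (shift η ξ h)) • sovBra η ξ h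

/-- The right separate state
`|Q⟩ = ∑_h ∏ₙ Q(ξₙ^{(hₙ)}) V(ξ₁^{(1-h₁)}, …, ξ_N^{(1-h_N)}) |h⟩`. -/
def sepKet {N : ℕ} (η : ℂ) (ξ : Fin N → ℂ) (Q : ℂ[X]) : (Fin N → Fin 2) → ℂ :=
  ∑ h : Fin N → Fin 2,
    ((∏ n, Q.eval (shift η ξ h n)) * vdm (shift η ξ fun n => 1 - h n)) • sovKet η ξ h

/-- The pairing `⟨P|Q⟩` of a left and a right separate state. -/
def sepPairing {N : ℕ} (η : ℂ) (ξ : Fin N → ℂ) (P Q : ℂ[X]) : ℂ :=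
  sepBra η ξ P ⬝ᵥ sepKet η ξ Q

/-- The elementary block `⟨Q| ∏_{j=1}^m E_j^{ε_{2j-1},ε_{2j}} |Q⟩ / ⟨Q|Q⟩`, where
`ε j = (ε_{2j-1}, ε_{2j})`. -/
def elementaryBlock {N m : ℕ} (η : ℂ) (ξ : Fin N → ℂ) (hm : m ≤ N) (Q : ℂ[X])
    (ε : Fin m → Fin 2 × Fin 2) : ℂ :=
  (sepBra η ξ Q ⬝ᵥ
    ((List.ofFn fun j : Fin m => elemAt (Fin.castLE hm j) (ε j).1 (ε j).2).prod *ᵥ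
      sepKet η ξ Q)) / sepPairing η ξ Q Q

/-! ### The index sets of the multiple sum

All indices start at `0` here: the site or operator index `j = 1, …, m` is `j : Fin m` with value
`j - 1`, and the index `b = 1, …, R + m` of a parameter is `b : Fin (R + m)` with value `b - 1`. -/

/-- The monic polynomial with roots `q j`, `j ∈ s`. -/
def rootPoly {ι : Type*} (s : Finset ι) (q : ι → ℂ) : ℂ[X] := ∏ j ∈ s, (X - C (q j))

/-- The Bethe roots followed by the first `m` inhomogeneities. -/
def params {N R m : ℕ} (hm : m ≤ N) (ξ : Fin N → ℂ) (lam : Fin R → ℂ) : Fin (R + m) → ℂ :=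
  Fin.append lam fun j : Fin m => ξ (Fin.castLE hm j)

/-- `α⁻ = {j : ε_{2j-1} = 1}`. -/
def alphaMinus {m : ℕ} (ε : Fin m → Fin 2 × Fin 2) : Finset (Fin m) :=
  Finset.univ.filter fun j => (ε j).1 = 0

/-- `α⁺ = {j : ε_{2j} = 2}`. -/
def alphaPlus {m : ℕ} (ε : Fin m → Fin 2 × Fin 2) : Finset (Fin m) :=
  Finset.univ.filter fun j => (ε j).2 = 1

/-- `A_{j+1} = {b : b ≠ a_k, a'_k for k < j + 1}`, with `j` starting from `0`. -/
def setA {R m : ℕ} {bm bp : Finset (Fin m)} (a : bm → Fin (R + m)) (a' : bp → Fin (R + m))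
    (j : ℕ) : Finset (Fin (R + m)) :=
  Finset.univ.filter fun b =>
    (∀ k : bm, (k : Fin m).val < j → b ≠ a k) ∧ (∀ k : bp, (k : Fin m).val < j → b ≠ a' k)

/-- `A'_{j+1} = {b : b ≠ a'_k for k < j + 1 and b ≠ a_k for k ≤ j + 1}`, with `j` starting
from `0`. -/
def setA' {R m : ℕ} {bm bp : Finset (Fin m)} (a : bm → Fin (R + m)) (a' : bp → Fin (R + m))
    (j : ℕ) : Finset (Fin (R + m)) :=
  Finset.univ.filter fun b =>
    (∀ k : bm, (k : Fin m).val ≤ j → b ≠ a k) ∧ (∀ k : bp, (k : Fin m).val < j → b ≠ a' k)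

/-- The choices `a_j`, `j ∈ ᾱ⁻`, and `a'_j`, `j ∈ ᾱ⁺`, over which the inner sum runs
(`bm = ᾱ⁻`, `bp = ᾱ⁺`): `a_j ≤ R + j`, `a_j ∈ A_j`, `a'_j ≤ R + j`, `a'_j ∈ A'_j` for indices
starting from `1`. -/
def indexChoices (R : ℕ) {m : ℕ} (bm bp : Finset (Fin m)) :
    Finset ((bm → Fin (R + m)) × (bp → Fin (R + m))) :=
  Finset.univ.filter fun c =>
    (∀ j : bm, (c.1 j).val < R + ((j : Fin m).val + 1) ∧ c.1 j ∈ setA c.1 c.2 (j : Fin m).val) ∧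
    (∀ j : bp, (c.2 j).val < R + ((j : Fin m).val + 1) ∧ c.2 j ∈ setA' c.1 c.2 (j : Fin m).val)

/-- The factor attached to `j ∈ ᾱ⁻`. -/
def weightMinus {N R m : ℕ} (η : ℂ) (ξ : Fin N → ℂ) (q : Fin (R + m) → ℂ)
    {bm bp : Finset (Fin m)} (a : bm → Fin (R + m)) (a' : bp → Fin (R + m)) (j : bm) : ℂ :=
  (dFun ξ (q (a j)) *
      ∏ k ∈ (setA a a' (j : Fin m).val).filter (fun k => k.val < R + (j : Fin m).val),
        (q (a j) - q k + η)) /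
    ∏ k ∈ (setA' a a' (j : Fin m).val).filter (fun k => k.val < R + ((j : Fin m).val + 1)),
      (q (a j) - q k)

/-- The factor attached to `j ∈ ᾱ⁺`. -/
def weightPlus {N R m : ℕ} (η : ℂ) (ξ : Fin N → ℂ) (q : Fin (R + m) → ℂ)
    {bm bp : Finset (Fin m)} (a : bm → Fin (R + m)) (a' : bp → Fin (R + m)) (j : bp) : ℂ :=
  -((aFun η ξ (q (a' j)) *
      ∏ k ∈ (setA' a a' (j : Fin m).val).filter (fun k => k.val < R + (j : Fin m).val),
        (q k - q (a' j) + η)) /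
    ∏ k ∈ (setA a a' ((j : Fin m).val + 1)).filter (fun k => k.val < R + ((j : Fin m).val + 1)),
      (q k - q (a' j)))

end

end AntiperiodicXXX

namespace AntiperiodicXXX

noncomputable section

/-! ### Interpolation -/

/-- `f` agrees with a polynomial of degree less than `n`. -/
def IsPolyLT (n : ℕ) (f : ℂ → ℂ) : Prop := ∃ p : ℂ[X], p.degree < n ∧ ∀ z, f z = p.eval z

lemma IsPolyLT.add {n : ℕ} {f g : ℂ → ℂ} (hf : IsPolyLT n f) (hg : IsPolyLT n g) :
    IsPolyLT n (fun z => f z + g z) := by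
  obtain ⟨p, hp, hp'⟩ := hf
  obtain ⟨r, hr, hr'⟩ := hg
  exact ⟨p + r, (degree_add_le _ _).trans_lt (max_lt hp hr), fun z => by simp [hp', hr']⟩

lemma IsPolyLT.const_mul {n : ℕ} {f : ℂ → ℂ} (hf : IsPolyLT n f) (c : ℂ) :
    IsPolyLT n (fun z => c * f z) := by
  obtain ⟨p, hp, hp'⟩ := hf
  exact ⟨c • p, (degree_smul_le _ _).trans_lt hp, fun z => by simp [hp']⟩

lemma IsPolyLT.zero (n : ℕ) : IsPolyLT n (fun _ => 0) :=
  ⟨0, by simp, fun z => by simp⟩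

lemma IsPolyLT.sum {ι : Type*} {n : ℕ} (s : Finset ι) {f : ι → ℂ → ℂ}
    (hf : ∀ i ∈ s, IsPolyLT n (f i)) : IsPolyLT n (fun z => ∑ i ∈ s, f i z) := by
  classical
  induction s using Finset.induction_on with
  | empty => simpa using IsPolyLT.zero n
  | insert i s hi ih =>
    simp only [Finset.sum_insert hi]
    exact (hf i (by simp)).add (ih fun j hj => hf j (by simp [hj]))

lemma IsPolyLT.mono {n k : ℕ} {f : ℂ → ℂ} (hf : IsPolyLT n f) (h : n ≤ k) : IsPolyLT k f := by
  obtain ⟨p, hp, hp'⟩ := hf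
  exact ⟨p, hp.trans_le (by exact_mod_cast h), hp'⟩

lemma IsPolyLT.sub_mul {n : ℕ} {f : ℂ → ℂ} (hf : IsPolyLT n f) (c : ℂ) :
    IsPolyLT (n + 1) (fun z => (z - c) * f z) := by
  obtain ⟨p, hp, hp'⟩ := hf
  refine ⟨(X - C c) * p, ?_, fun z => by simp [hp']⟩
  by_cases h0 : p = 0
  · simp [h0]
  · rw [degree_mul, degree_X_sub_C, degree_eq_natDegree h0] at *
    have : p.natDegree < n := by exact_mod_cast hp
    have h2 : 1 + p.natDegree < n + 1 := by omega
    exact_mod_cast h2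

lemma IsPolyLT.one : IsPolyLT 1 (fun _ => 1) := ⟨1, by simp, fun z => by simp⟩

lemma IsPolyLT.continuous {n : ℕ} {f : ℂ → ℂ} (hf : IsPolyLT n f) : Continuous f := by
  obtain ⟨p, -, hp⟩ := hf
  rw [funext hp]
  exact p.continuous

lemma IsPolyLT.eq_sum {N : ℕ} {f : ℂ → ℂ} (hf : IsPolyLT N f) {x : Fin N → ℂ}
    (hx : Function.Injective x) (z : ℂ) :
    f z = ∑ a, f (x a) * ∏ b ∈ Finset.univ.erase a, ((z - x b) / (x a - x b)) := by
  obtain ⟨p, hp, hp'⟩ := hf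
  have := Lagrange.eq_interpolate (s := Finset.univ) (v := x) (f := p) hx.injOn (by simpa using hp)
  rw [hp', this, Lagrange.interpolate_apply, eval_finsetSum]
  refine Finset.sum_congr rfl fun a _ => ?_
  rw [eval_mul, eval_C, Lagrange.basis, eval_prod, hp']
  congr 1
  refine Finset.prod_congr rfl fun b _ => ?_
  simp [Lagrange.basisDivisor, div_eq_inv_mul]

lemma sum_residues_of_disjoint {N : ℕ} {κ : Type*} [DecidableEq κ] {x : Fin N → ℂ}
    (hx : Function.Injective x) {s : Finset κ} {q : κ → ℂ} (hq : Set.InjOn q s)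
    (hxq : ∀ b, ∀ k ∈ s, x b ≠ q k) {F : ℂ[X]} (hF : F.Monic)
    (hdeg : F.natDegree + 1 = N + s.card) :
    ∑ a, F.eval (x a) *
        ∏ b ∈ Finset.univ.erase a, (-(∏ k ∈ s, (x b - q k)) / (x a - x b)) =
      -((-1) ^ N * ∏ b, ∏ k ∈ s, (x b - q k)) +
        ∑ p ∈ s, F.eval (q p) / (∏ k ∈ s.erase p, (q p - q k)) *
          ∏ b, ∏ k ∈ s.erase p, (x b - q k) := by
  have hinj : Set.InjOn (Sum.elim x q) (Finset.univ.disjSum s : Finset (Fin N ⊕ κ)) := by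
    rintro (a | a) ha (b | b) hb h <;>
      simp only [Finset.mem_coe, Finset.inl_mem_disjSum, Finset.inr_mem_disjSum, Sum.elim_inl,
        Sum.elim_inr] at ha hb h
    · rw [hx h]
    · exact absurd h (hxq _ _ hb)
    · exact absurd h.symm (hxq _ _ ha)
    · rw [hq ha hb h]
  have hpos : (Finset.univ.disjSum s : Finset (Fin N ⊕ κ)).card = N + s.card := by simp
  have key := Lagrange.leadingCoeff_eq_sum hinj (P := F) (by
    rw [hpos, degree_eq_natDegree hF.ne_zero, ← hdeg]; norm_cast)
  rw [hF.leadingCoeff, Finset.sum_disjSum] at key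
  have e1 : ∀ a : Fin N, (Finset.univ.disjSum s).erase (Sum.inl a) =
      (Finset.univ.erase a).disjSum s := by
    intro a; ext (b | b) <;> simp
  have e2 : ∀ a : κ, (Finset.univ.disjSum s).erase (Sum.inr a) =
      (Finset.univ : Finset (Fin N)).disjSum (s.erase a) := by
    intro a; ext (b | b) <;> simp
  simp only [e1, e2, Finset.prod_disjSum, Sum.elim_inl, Sum.elim_inr] at key
  have hP : ∀ b, (∏ k ∈ s, (x b - q k)) ≠ 0 := fun b =>
    Finset.prod_ne_zero_iff.2 fun k hk => sub_ne_zero.2 (hxq b k hk)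
  have h1 : ∀ a, F.eval (x a) *
      ∏ b ∈ Finset.univ.erase a, (-(∏ k ∈ s, (x b - q k)) / (x a - x b)) =
      -((-1) ^ N * ∏ b, ∏ k ∈ s, (x b - q k)) * (F.eval (x a) /
        ((∏ b ∈ Finset.univ.erase a, (x a - x b)) * ∏ k ∈ s, (x a - q k))) := by
    intro a
    have : (-1) ^ N * ∏ b, ∏ k ∈ s, (x b - q k) = ∏ b, (-∏ k ∈ s, (x b - q k)) := by
      rw [Finset.prod_neg]; simp
    rw [this, ← Finset.mul_prod_erase _ _ (Finset.mem_univ a), Finset.prod_div_distrib]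
    have hd : (∏ b ∈ Finset.univ.erase a, (x a - x b)) ≠ 0 :=
      Finset.prod_ne_zero_iff.2 fun b hb =>
        sub_ne_zero.2 fun h => (Finset.ne_of_mem_erase hb) (hx h).symm
    have := hP a
    field_simp
  have h2 : ∀ p ∈ s, F.eval (q p) / (∏ k ∈ s.erase p, (q p - q k)) *
      ∏ b, ∏ k ∈ s.erase p, (x b - q k) =
      ((-1) ^ N * ∏ b, ∏ k ∈ s, (x b - q k)) * (F.eval (q p) /
        ((∏ b, (q p - x b)) * ∏ k ∈ s.erase p, (q p - q k))) := by
    intro p hp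
    have : (∏ b, (q p - x b)) = (-1) ^ N * ∏ b, (x b - q p) := by
      simpa using Finset.prod_neg (s := Finset.univ) (fun b => x b - q p)
    have e3 : ∏ b, ∏ k ∈ s, (x b - q k) =
        (∏ b, (x b - q p)) * ∏ b, ∏ k ∈ s.erase p, (x b - q k) := by
      rw [← Finset.prod_mul_distrib]
      exact Finset.prod_congr rfl fun b _ => (Finset.mul_prod_erase _ _ hp).symm
    rw [this, e3]
    have hd : (∏ b, (x b - q p)) ≠ 0 :=
      Finset.prod_ne_zero_iff.2 fun b _ => sub_ne_zero.2 (hxq b p hp)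
    have hd' : (∏ k ∈ s.erase p, (q p - q k)) ≠ 0 :=
      Finset.prod_ne_zero_iff.2 fun b hb => sub_ne_zero.2 fun h =>
        (Finset.ne_of_mem_erase hb) (hq hp (Finset.mem_of_mem_erase hb) h).symm
    field_simp
  rw [Finset.sum_congr rfl fun a _ => h1 a, Finset.sum_congr rfl h2, ← Finset.mul_sum,
    ← Finset.mul_sum]
  linear_combination (((-1) ^ N * ∏ b, ∏ k ∈ s, (x b - q k))) * key

/-- The residue theorem for `F(z) / (∏_b (z - x_b) ∏_k (z - q_k))`, with denominators cleared so
that the points `q_k` may coincide with some of the `x_b`. -/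
lemma sum_residues {N : ℕ} {κ : Type*} [DecidableEq κ] {x : Fin N → ℂ}
    (hx : Function.Injective x) {s : Finset κ} {q : κ → ℂ} (hq : Set.InjOn q s)
    {F : ℂ[X]} (hF : F.Monic) (hdeg : F.natDegree + 1 = N + s.card) :
    ∑ a, F.eval (x a) *
        ∏ b ∈ Finset.univ.erase a, (-(∏ k ∈ s, (x b - q k)) / (x a - x b)) =
      -((-1) ^ N * ∏ b, ∏ k ∈ s, (x b - q k)) +
        ∑ p ∈ s, F.eval (q p) / (∏ k ∈ s.erase p, (q p - q k)) *
          ∏ b, ∏ k ∈ s.erase p, (x b - q k) := by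
  let f : ℂ → ℂ := fun t => ∑ a, F.eval (x a) *
        ∏ b ∈ Finset.univ.erase a, (-(∏ k ∈ s, (x b - (q k + t))) / (x a - x b))
  let g : ℂ → ℂ := fun t => -((-1) ^ N * ∏ b, ∏ k ∈ s, (x b - (q k + t))) +
        ∑ p ∈ s, F.eval (q p + t) / (∏ k ∈ s.erase p, (q p - q k)) *
          ∏ b, ∏ k ∈ s.erase p, (x b - (q k + t))
  have hf : Continuous f := by
    refine continuous_finsetSum _ fun a _ => continuous_const.mul ?_
    refine continuous_finsetProd _ fun b _ => ?_
    fun_prop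
  have hg : Continuous g := by
    refine Continuous.add (by fun_prop) (continuous_finsetSum _ fun p _ => ?_)
    refine Continuous.mul (Continuous.div_const ?_ _) (by fun_prop)
    exact F.continuous.comp (by fun_prop)
  let bad : Set ℂ := ⋃ b : Fin N, ⋃ k ∈ s, {x b - q k}
  have hbad : bad.Finite :=
    Set.finite_iUnion fun b => s.finite_toSet.biUnion fun k _ => Set.finite_singleton _
  have hdense : Dense badᶜ := hbad.countable.dense_compl ℂ
  have heq : f = g := hf.ext_on hdense hg fun t ht => by
    have h := sum_residues_of_disjoint hx (s := s) (q := fun k => q k + t)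
      (fun i hi j hj h => hq hi hj (add_right_cancel h)) (fun b k hk h => ht (by
        simp only [bad, Set.mem_iUnion, Set.mem_singleton_iff]
        exact ⟨b, k, hk, by rw [h]; ring⟩)) hF hdeg
    simpa only [f, g, add_sub_add_right_eq_sub] using h
  simpa [f, g] using congrFun heq 0

/-! ### Two-by-two matrices satisfying the Yang–Baxter relations -/

/-- The quadratic relations `R(x - y) T₁(x) T₂(y) = T₂(y) T₁(x) R(x - y)`, entry by entry. -/
def IsRTT {𝒜 : Type*} [Ring 𝒜] [Algebra ℂ 𝒜] (η : ℂ) (T : ℂ → Matrix (Fin 2) (Fin 2) 𝒜) : Prop :=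
  ∀ x y i j k l, (x - y) • (T x i j * T y k l - T y k l * T x i j) =
    η • (T y k j * T x i l - T x k j * T y i l)

/-- The entries of `T` satisfy the quantum determinant identities with value `δ`. -/
def HasQDet {𝒜 : Type*} [Ring 𝒜] [Algebra ℂ 𝒜] (η : ℂ) (T : ℂ → Matrix (Fin 2) (Fin 2) 𝒜)
    (δ : ℂ → ℂ) : Prop :=
  ∀ x i j k l, T x i j * T (x - η) k l - T x i l * T (x - η) k j =
    (δ x * (((k.val : ℂ) - i.val) * ((l.val : ℂ) - j.val))) • (1 : 𝒜)

/-- The part of `T₁(c) T₂(c - η)` symmetric in the row indices vanishes. -/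
def SymVanish {𝒜 : Type*} [Ring 𝒜] (η : ℂ) (T : ℂ → Matrix (Fin 2) (Fin 2) 𝒜) (c : ℂ) : Prop :=
  ∀ i j k l, T c i j * T (c - η) k l + T c k j * T (c - η) i l = 0

/-- All entries of `L` commute with all entries of `T`. -/
def EntriesCommute {𝒜 : Type*} [Ring 𝒜] (L T : ℂ → Matrix (Fin 2) (Fin 2) 𝒜) : Prop :=
  ∀ x y i j k l, L x i j * T y k l = T y k l * L x i j

/-- The relations between matrix units of `M₂(ℂ)`. -/
structure IsMatrixUnits {𝒜 : Type*} [Ring 𝒜] (e : Fin 2 → Fin 2 → 𝒜) : Prop where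
  mul : ∀ i j k l, e i j * e k l = if j = k then e i l else 0
  one : e 0 0 + e 1 1 = 1

/-- The Lax matrix with entries `(z - c) δ_{ij} + η e_{ji}`. -/
def lax {𝒜 : Type*} [Ring 𝒜] [Algebra ℂ 𝒜] (η c : ℂ) (e : Fin 2 → Fin 2 → 𝒜) (z : ℂ) :
    Matrix (Fin 2) (Fin 2) 𝒜 :=
  Matrix.of fun i j => (if i = j then z - c else 0) • (1 : 𝒜) + η • e j i

section

variable {𝒜 : Type*} [Ring 𝒜]

lemma EntriesCommute.left_comm {L T : ℂ → Matrix (Fin 2) (Fin 2) 𝒜} (h : EntriesCommute L T)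
    (x y : ℂ) (i j k l : Fin 2) (Z : 𝒜) :
    T y k l * (L x i j * Z) = L x i j * (T y k l * Z) := by
  rw [← mul_assoc, ← h, mul_assoc]

/-- Conjugation by `σˣ` in the auxiliary space. -/
def flip (T : ℂ → Matrix (Fin 2) (Fin 2) 𝒜) (z : ℂ) : Matrix (Fin 2) (Fin 2) 𝒜 :=
  Matrix.of fun i j => T z (1 - i) (1 - j)

lemma flip_mul (L T : ℂ → Matrix (Fin 2) (Fin 2) 𝒜) :
    flip (fun z => L z * T z) = fun z => flip L z * flip T z := by
  funext z
  ext i j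
  simp only [flip, Matrix.mul_apply, Fin.sum_univ_two, Matrix.of_apply]
  exact add_comm _ _

lemma EntriesCommute.flip_left {L T : ℂ → Matrix (Fin 2) (Fin 2) 𝒜} (h : EntriesCommute L T) :
    EntriesCommute (flip L) T := fun x y i j k l => h x y (1 - i) (1 - j) k l

/-- The twisted transfer matrix `tr (σˣ T(z))`. -/
def twist (T : ℂ → Matrix (Fin 2) (Fin 2) 𝒜) (z : ℂ) : 𝒜 := T z 0 1 + T z 1 0

lemma SymVanish.mul_left {η c : ℂ} {L T : ℂ → Matrix (Fin 2) (Fin 2) 𝒜}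
    (hL : SymVanish η L c) (hc : EntriesCommute L T) : SymVanish η (fun z => L z * T z) c := by
  intro i j k l
  have h1 : ∀ p r, _ := fun p r => congrArg (· * (T c p j * T (c - η) r l)) (hL i p k r)
  simp only [Matrix.mul_apply, Fin.sum_univ_two, mul_add, add_mul, mul_assoc, hc.left_comm,
    zero_mul] at h1 ⊢
  linear_combination (norm := module) h1 0 0 + h1 0 1 + h1 1 0 + h1 1 1

variable [Algebra ℂ 𝒜]

lemma IsRTT.mul {η : ℂ} {L T : ℂ → Matrix (Fin 2) (Fin 2) 𝒜} (hL : IsRTT η L) (hT : IsRTT η T)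
    (hc : EntriesCommute L T) : IsRTT η (fun z => L z * T z) := by
  intro x y i j k l
  have h1 : ∀ p r, _ := fun p r => congrArg (· * (T x p j * T y r l)) (hL x y i p k r)
  have h2 : ∀ p r, _ := fun p r => congrArg (L y k r * L x i p * ·) (hT x y p j r l)
  simp only [Matrix.mul_apply, Fin.sum_univ_two, mul_add, add_mul, mul_sub, sub_mul,
    smul_mul_assoc, mul_smul_comm, mul_assoc, hc.left_comm] at h1 h2 ⊢
  linear_combination (norm := module) h1 0 0 + h1 0 1 + h1 1 0 + h1 1 1 + h2 0 0 + h2 0 1 +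
    h2 1 0 + h2 1 1

lemma HasQDet.mul {η : ℂ} {L T : ℂ → Matrix (Fin 2) (Fin 2) 𝒜} {δ δ' : ℂ → ℂ}
    (hL : HasQDet η L δ) (hT : HasQDet η T δ') (hc : EntriesCommute L T) :
    HasQDet η (fun z => L z * T z) (fun z => δ z * δ' z) := by
  intro x i j k l
  have h1 : ∀ p r, _ := fun p r => congrArg (L x i p * L (x - η) k r * ·) (hT x p j r l)
  have h2 := congrArg ((δ' x * ((l.val : ℂ) - j.val)) • ·) (hL x i 0 k 1)
  simp only [Matrix.mul_apply, Fin.sum_univ_two, mul_add, add_mul, mul_sub, sub_mul,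
    mul_smul_comm, mul_assoc, hc.left_comm, mul_one] at h1 h2 ⊢
  have h00 := h1 0 0
  have h01 := h1 0 1
  have h10 := h1 1 0
  have h11 := h1 1 1
  simp at h00 h01 h10 h11 h2
  linear_combination (norm := (simp only [sub_smul, mul_smul, smul_sub]; module))
    h00 + h01 + h10 + h11 + h2

lemma SymVanish.mul_right {η c : ℂ} (hη : η ≠ 0) {L T : ℂ → Matrix (Fin 2) (Fin 2) 𝒜}
    (hL : IsRTT η L) (hT : SymVanish η T c) (hc : EntriesCommute L T) :
    SymVanish η (fun z => L z * T z) c := by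
  intro i j k l
  have hs : L c i 0 * L (c - η) k 1 + L c k 0 * L (c - η) i 1 =
      L c i 1 * L (c - η) k 0 + L c k 1 * L (c - η) i 0 := by
    have e1 := hL c (c - η) i 0 k 1
    have e2 := hL c (c - η) i 1 k 0
    rw [sub_sub_cancel] at e1 e2
    have e1' := smul_right_injective _ hη e1
    have e2' := smul_right_injective _ hη e2
    linear_combination (norm := module) e1' - e2'
  have h1 : ∀ p r, _ := fun p r => congrArg (L c i p * L (c - η) k r * ·) (hT p j r l)
  have h2 : ∀ p r, _ := fun p r => congrArg (L c k p * L (c - η) i r * ·) (hT p j r l)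
  have h3 := congrArg (· * (T c 0 j * T (c - η) 1 l)) hs
  have h4 := congrArg (· * (T c 1 j * T (c - η) 0 l)) hs
  simp only [Matrix.mul_apply, Fin.sum_univ_two, mul_add, add_mul, mul_assoc, hc.left_comm,
    mul_zero] at h1 h2 h3 h4 ⊢
  linear_combination (norm := module) (1 / 2 : ℂ) • (h1 0 0 + h2 0 0 + h1 1 1 + h2 1 1) +
    h1 1 0 + h2 1 0 + h3

lemma lax_isRTT (η c : ℂ) {e : Fin 2 → Fin 2 → 𝒜} (he : IsMatrixUnits e) :
    IsRTT η (lax η c e) := by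
  intro x y i j k l
  simp only [lax, Matrix.of_apply, mul_add, add_mul, smul_mul_assoc, mul_smul_comm, he.mul,
    one_mul, mul_one]
  fin_cases i <;> fin_cases j <;> fin_cases k <;> fin_cases l <;>
    simp [-smul_eq_zero, -zero_eq_mul] <;> module

lemma lax_hasQDet (η c : ℂ) {e : Fin 2 → Fin 2 → 𝒜} (he : IsMatrixUnits e) :
    HasQDet η (lax η c e) (fun z => (z - c + η) * (z - η - c)) := by
  intro x i j k l
  simp only [lax, Matrix.of_apply, mul_add, add_mul, smul_mul_assoc, mul_smul_comm, he.mul,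
    one_mul, mul_one]
  rw [← he.one]
  fin_cases i <;> fin_cases j <;> fin_cases k <;> fin_cases l <;> simp <;> module

lemma lax_symVanish (η c : ℂ) {e : Fin 2 → Fin 2 → 𝒜} (he : IsMatrixUnits e) :
    SymVanish η (lax η c e) c := by
  intro i j k l
  simp only [lax, Matrix.of_apply, mul_add, add_mul, smul_mul_assoc, mul_smul_comm, he.mul,
    one_mul, mul_one]
  fin_cases i <;> fin_cases j <;> fin_cases k <;> fin_cases l <;> simp

lemma IsRTT.flip {η : ℂ} {T : ℂ → Matrix (Fin 2) (Fin 2) 𝒜} (h : IsRTT η T) :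
    IsRTT η (flip T) := fun x y i j k l => h x y (1 - i) (1 - j) (1 - k) (1 - l)

/-- The twisted transfer matrix at the inhomogeneity of the last factor moves this factor to the
front. -/
lemma twist_mul_intertwine {η c : ℂ} {X : ℂ → Matrix (Fin 2) (Fin 2) 𝒜} {e : Fin 2 → Fin 2 → 𝒜}
    (he : IsMatrixUnits e) (hX : IsRTT η X) (hc : ∀ x i j k l, X x i j * e k l = e k l * X x i j)
    (z : ℂ) (a b : Fin 2) :
    twist (fun z => X z * lax η c e z) c * (X z * lax η c e z) a b =
      (flip (lax η c e) z * X z) a b * twist (fun z => X z * lax η c e z) c := by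
  have hc' : ∀ x i j k l Z, X x i j * (e k l * Z) = e k l * (X x i j * Z) := fun x i j k l Z => by
    rw [← mul_assoc, hc, mul_assoc]
  have h1 : ∀ d f, _ := fun d f => congrArg (e (1 - d) f * ·) (hX z c a b d f)
  have hee : ∀ i j k l Z, e i j * (e k l * Z) = if j = k then e i l * Z else 0 :=
    fun i j k l Z => by rw [← mul_assoc, he.mul]; split_ifs <;> simp
  simp only [twist, flip, lax, Matrix.mul_apply, Fin.sum_univ_two, Matrix.of_apply, mul_add,
    add_mul, mul_sub, smul_mul_assoc, mul_smul_comm, mul_assoc, hc, hc', hee, one_mul,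
    mul_one] at h1 ⊢
  have h00 := h1 0 0
  have h01 := h1 0 1
  have h10 := h1 1 0
  have h11 := h1 1 1
  fin_cases a <;> fin_cases b <;> simp at h00 h01 h10 h11 ⊢ <;>
  linear_combination (norm := module) -η • (h00 + h01 + h10 + h11)

/-- Reconstruction of the matrix units of the last factor. -/
lemma unit_mul_twist {η c : ℂ} {X : ℂ → Matrix (Fin 2) (Fin 2) 𝒜} {e : Fin 2 → Fin 2 → 𝒜}
    (he : IsMatrixUnits e) (hc : ∀ x i j k l, X x i j * e k l = e k l * X x i j) (a b : Fin 2) :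
    e b (1 - a) * twist (fun z => X z * lax η c e z) c = (X c * lax η c e c) a b := by
  have hee : ∀ i j k l Z, e i j * (e k l * Z) = if j = k then e i l * Z else 0 :=
    fun i j k l Z => by rw [← mul_assoc, he.mul]; split_ifs <;> simp
  simp only [twist, lax, Matrix.mul_apply, Fin.sum_univ_two, Matrix.of_apply, mul_add,
    mul_smul_comm, hc, hee, mul_one]
  fin_cases a <;> fin_cases b <;> simp

end

/-! ### Separation of variables for covectors -/

/-- What separation of variables uses of a monodromy matrix `T` and of the reference covector
`ω`. -/
structure IsSoVRep {N : ℕ} {S : Type*} [Fintype S] [DecidableEq S] (η : ℂ) (ξ : Fin N → ℂ)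
    (T : ℂ → Matrix (Fin 2) (Fin 2) (Matrix S S ℂ)) (ω : S → ℂ) : Prop where
  rtt : IsRTT η T
  qdet : HasQDet η T (fun z => aFun η ξ z * dFun ξ (z - η))
  sym : ∀ n, SymVanish η T (ξ n)
  poly : ∀ i j, i ≠ j → ∀ s t, IsPolyLT N (fun z => T z i j s t)
  cont : ∀ s t, Continuous (fun z => T z 1 1 s t)
  vac_B : ∀ z, ω ᵥ* T z 0 1 = 0
  vac_D : ∀ z, ω ᵥ* T z 1 1 = dFun ξ z • ω

/-- The inhomogeneities are generic. -/
def Generic {N : ℕ} (η : ℂ) (ξ : Fin N → ℂ) : Prop :=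
  η ≠ 0 ∧ ∀ i j, i ≠ j → ξ i ≠ ξ j ∧ ξ i ≠ ξ j + η ∧ ξ i ≠ ξ j - η

lemma Generic.dFun_ne_zero {N : ℕ} {η : ℂ} {ξ : Fin N → ℂ} (h : Generic η ξ) (n : Fin N) :
    dFun ξ (ξ n - η) ≠ 0 := by
  refine Finset.prod_ne_zero_iff.2 fun k _ h0 => ?_
  by_cases hk : n = k
  · subst hk
    exact h.1 (by linear_combination -h0)
  · exact (h.2 n k hk).2.1 (by linear_combination h0)

lemma Generic.aFun_ne_zero {N : ℕ} {η : ℂ} {ξ : Fin N → ℂ} (h : Generic η ξ) (n : Fin N) :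
    aFun η ξ (ξ n) ≠ 0 := by
  refine Finset.prod_ne_zero_iff.2 fun k _ h0 => ?_
  by_cases hk : n = k
  · subst hk
    exact h.1 (by linear_combination h0)
  · exact (h.2 n k hk).2.2 (by linear_combination h0)

lemma dFun_self {N : ℕ} (ξ : Fin N → ℂ) (n : Fin N) : dFun ξ (ξ n) = 0 :=
  Finset.prod_eq_zero (Finset.mem_univ n) (sub_self _)

lemma aFun_self_sub {N : ℕ} (η : ℂ) (ξ : Fin N → ℂ) (n : Fin N) : aFun η ξ (ξ n - η) = 0 :=
  Finset.prod_eq_zero (Finset.mem_univ n) (by ring)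

lemma fin_two_eq_zero_or_one (i : Fin 2) : i = 0 ∨ i = 1 := by omega

lemma Generic.shift_injective {N : ℕ} {η : ℂ} {ξ : Fin N → ℂ} (hg : Generic η ξ)
    (h : Fin N → Fin 2) : Function.Injective (shift η ξ h) := by
  intro i j hij
  by_contra hne
  obtain ⟨h1, h2, h3⟩ := hg.2 i j hne
  simp only [shift] at hij
  rcases fin_two_eq_zero_or_one (h i) with hi | hi <;>
    rcases fin_two_eq_zero_or_one (h j) with hj | hj <;> simp [hi, hj] at hij
  · exact h1 hij
  · exact h3 hij
  · exact h2 (by linear_combination hij)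
  · exact h1 hij

/-- Reversal of the value at `a`. -/
def flipAt {N : ℕ} (h : Fin N → Fin 2) (a : Fin N) : Fin N → Fin 2 := Function.update h a (1 - h a)

lemma flipAt_self {N : ℕ} (h : Fin N → Fin 2) (a : Fin N) : flipAt h a a = 1 - h a := by
  simp [flipAt]

lemma flipAt_flipAt {N : ℕ} (h : Fin N → Fin 2) (a : Fin N) : flipAt (flipAt h a) a = h := by
  simp [flipAt]

lemma shift_flipAt {N : ℕ} (η : ℂ) (ξ : Fin N → ℂ) (h : Fin N → Fin 2) (a : Fin N) :
    shift η ξ (flipAt h a) =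
      Function.update (shift η ξ h) a (shift η ξ (flipAt h a) a) := by
  funext b
  by_cases hb : b = a
  · subst hb; simp
  · simp [shift, flipAt, hb]

lemma shift_flipAt_of_ne {N : ℕ} (η : ℂ) (ξ : Fin N → ℂ) (h : Fin N → Fin 2) {a b : Fin N}
    (hb : b ≠ a) : shift η ξ (flipAt h a) b = shift η ξ h b := by
  rw [shift_flipAt, Function.update_of_ne hb]

lemma sum_flipAt {N : ℕ} {M : Type*} [AddCommMonoid M] (a : Fin N) (f : (Fin N → Fin 2) → M) :
    ∑ h, f (flipAt h a) = ∑ h, f h :=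
  Equiv.sum_comp (Function.Involutive.toPerm (fun h => flipAt h a) fun h => flipAt_flipAt h a) f

lemma induction_flipAt {N : ℕ} {p : (Fin N → Fin 2) → Prop} (h0 : p fun _ => 0)
    (hs : ∀ h a, h a = 0 → p h → p (flipAt h a)) (h : Fin N → Fin 2) : p h := by
  suffices H : ∀ (s : Finset (Fin N)) (h : Fin N → Fin 2), (∀ n, h n = 1 ↔ n ∈ s) → p h from
    H (Finset.univ.filter fun n => h n = 1) h (by simp)
  intro s
  induction s using Finset.induction_on with
  | empty =>
    intro h hh
    have : h = fun _ => 0 := funext fun n =>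
      (fin_two_eq_zero_or_one (h n)).resolve_right fun h1 => by simpa using (hh n).1 h1
    rw [this]; exact h0
  | insert a s ha ih =>
    intro h hh
    have h1 : h a = 1 := (hh a).2 (by simp)
    rw [← flipAt_flipAt h a]
    refine hs _ a (by rw [flipAt_self, h1]; rfl) (ih _ fun n => ?_)
    by_cases hn : n = a
    · subst hn; simp [flipAt_self, h1, ha]
    · rw [flipAt, Function.update_of_ne hn, hh]; simp [hn]

lemma vdm_update {N : ℕ} (x : Fin N → ℂ) (a : Fin N) :
    ∃ c, ∀ y, vdm (Function.update x a y) = c * ∏ b ∈ Finset.univ.erase a, (y - x b) := by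
  refine ⟨(∏ i ∈ Finset.univ.erase a, ∏ j ∈ (Finset.Ioi i).erase a, (x j - x i)) *
    ∏ i ∈ Finset.univ.erase a, if i < a then 1 else -1, fun y => ?_⟩
  have h1 : ∏ j ∈ Finset.Ioi a, (Function.update x a y j - Function.update x a y a) =
      ∏ i ∈ Finset.univ.erase a, if i < a then 1 else x i - y := by
    rw [Finset.prod_ite]
    simp only [Finset.prod_const_one, one_mul]
    refine Finset.prod_congr ?_ fun j hj => ?_
    · ext j
      simp only [Finset.mem_Ioi, Finset.mem_filter, Finset.mem_erase, Finset.mem_univ, and_true]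
      omega
    · have : j ≠ a := by
        simp only [Finset.mem_filter, Finset.mem_erase] at hj
        exact hj.1.1
      simp [this]
  have h2 : ∀ i ∈ Finset.univ.erase a,
      ∏ j ∈ Finset.Ioi i, (Function.update x a y j - Function.update x a y i) =
      (if i < a then y - x i else 1) * ∏ j ∈ (Finset.Ioi i).erase a, (x j - x i) := by
    intro i hi
    have hia : i ≠ a := Finset.ne_of_mem_erase hi
    have h3 : ∏ j ∈ (Finset.Ioi i).erase a, (Function.update x a y j - Function.update x a y i) =
        ∏ j ∈ (Finset.Ioi i).erase a, (x j - x i) :=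
      Finset.prod_congr rfl fun j hj => by simp [hia, Finset.ne_of_mem_erase hj]
    rw [← h3]
    split_ifs with hlt
    · rw [← Finset.mul_prod_erase _ _ (Finset.mem_Ioi.2 hlt)]
      simp [hia]
    · rw [Finset.erase_eq_of_notMem (by simpa using hlt), one_mul]
  have h4 : (∏ i ∈ Finset.univ.erase a, if i < a then 1 else x i - y) *
      (∏ i ∈ Finset.univ.erase a, if i < a then y - x i else 1) =
      (∏ i ∈ Finset.univ.erase a, if i < a then 1 else -1) *
        ∏ b ∈ Finset.univ.erase a, (y - x b) := by
    rw [← Finset.prod_mul_distrib, ← Finset.prod_mul_distrib]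
    refine Finset.prod_congr rfl fun i _ => ?_
    split_ifs <;> ring
  rw [vdm, ← Finset.mul_prod_erase _ _ (Finset.mem_univ a), h1, Finset.prod_congr rfl h2,
    Finset.prod_mul_distrib]
  linear_combination (∏ i ∈ Finset.univ.erase a, ∏ j ∈ (Finset.Ioi i).erase a, (x j - x i)) * h4

/-- The covector `ω ∏ₙ (C(ξₙ) / d(ξₙ - η))^{hₙ}`. -/
def bra {N : ℕ} {S : Type*} [Fintype S] [DecidableEq S] (η : ℂ) (ξ : Fin N → ℂ)
    (T : ℂ → Matrix (Fin 2) (Fin 2) (Matrix S S ℂ)) (ω : S → ℂ) (h : Fin N → Fin 2) : S → ℂ :=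
  ω ᵥ* (List.ofFn fun n : Fin N =>
      if h n = 1 then (dFun ξ (ξ n - η))⁻¹ • T (ξ n) 1 0 else 1).prod

/-- The separate covector of a polynomial. -/
def sep {N : ℕ} {S : Type*} [Fintype S] [DecidableEq S] (η : ℂ) (ξ : Fin N → ℂ)
    (T : ℂ → Matrix (Fin 2) (Fin 2) (Matrix S S ℂ)) (ω : S → ℂ) (P : ℂ[X]) : S → ℂ :=
  ∑ h : Fin N → Fin 2,
    ((∏ n, P.eval (shift η ξ h n)) * vdm (shift η ξ h)) • bra η ξ T ω h

lemma prod_ofFn_mul_eq_update {M : Type*} [Monoid M] {N : ℕ} (f : Fin N → M) (a : Fin N) (y : M)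
    (ha : f a = 1) (hy : ∀ n, Commute (f n) y) :
    (List.ofFn f).prod * y = (List.ofFn (Function.update f a y)).prod := by
  induction N with
  | zero => exact a.elim0
  | succ N ih =>
    rw [List.ofFn_succ, List.ofFn_succ, List.prod_cons, List.prod_cons]
    refine Fin.cases (fun ha => ?_) (fun a ha => ?_) a ha
    · have : (List.ofFn fun i => Function.update f 0 y (Fin.succ i)) =
          List.ofFn fun i => f (Fin.succ i) := by simp
      rw [this, ha, one_mul, Function.update_self]
      refine Commute.eq (Commute.list_prod_left _ _ fun z hz => ?_)
      obtain ⟨n, rfl⟩ := (List.mem_ofFn' _ _).1 hz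
      exact hy _
    · rw [mul_assoc, ih (fun i => f i.succ) a ha fun n => hy _]
      congr 3
      funext i
      by_cases hi : i = a
      · subst hi; simp
      · simp [hi]

section

variable {N : ℕ} {S : Type*} [Fintype S] [DecidableEq S] {η : ℂ} {ξ : Fin N → ℂ}
  {T : ℂ → Matrix (Fin 2) (Fin 2) (Matrix S S ℂ)} {ω : S → ℂ}

lemma IsRTT.commute_C (hη : η ≠ 0) (hT : IsRTT η T) (x y : ℂ) :
    Commute (T x 1 0) (T y 1 0) := by
  have h1 := hT x y 1 0 1 0
  have h2 := hT y x 1 0 1 0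
  have h3 : (2 * η) • (T x 1 0 * T y 1 0 - T y 1 0 * T x 1 0) = 0 := by
    linear_combination (norm := module) h1 - h2
  have h4 := (smul_eq_zero.1 h3).resolve_left (mul_ne_zero two_ne_zero hη)
  exact sub_eq_zero.1 h4

lemma bra_mul_C (hg : Generic η ξ) (hT : IsSoVRep η ξ T ω) (h : Fin N → Fin 2) (a : Fin N)
    (ha : h a = 0) :
    bra η ξ T ω h ᵥ* T (ξ a) 1 0 = dFun ξ (ξ a - η) • bra η ξ T ω (flipAt h a) := by
  have hd := hg.dFun_ne_zero a
  have key := prod_ofFn_mul_eq_update (fun n : Fin N =>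
      if h n = 1 then (dFun ξ (ξ n - η))⁻¹ • T (ξ n) 1 0 else 1) a
      ((dFun ξ (ξ a - η))⁻¹ • T (ξ a) 1 0) (by simp [ha]) (fun n => by
        split_ifs
        · exact ((hT.rtt.commute_C hg.1 _ _).smul_left _).smul_right _
        · exact Commute.one_left _)
  have e : (Function.update (fun n : Fin N =>
      if h n = 1 then (dFun ξ (ξ n - η))⁻¹ • T (ξ n) 1 0 else 1) a
      ((dFun ξ (ξ a - η))⁻¹ • T (ξ a) 1 0)) = fun n : Fin N =>
      if flipAt h a n = 1 then (dFun ξ (ξ n - η))⁻¹ • T (ξ n) 1 0 else 1 := by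
    funext n
    by_cases hn : n = a
    · subst hn; simp [flipAt_self, ha]
    · simp [flipAt, hn]
  rw [e] at key
  rw [bra, bra, ← key, mul_smul_comm, Matrix.vecMul_smul, Matrix.vecMul_vecMul, smul_smul,
    mul_inv_cancel₀ hd, one_smul]

lemma bra_zero : bra η ξ T ω (fun _ => 0) = ω := by
  simp [bra]

lemma bra_flipAt (hg : Generic η ξ) (hT : IsSoVRep η ξ T ω) (h : Fin N → Fin 2) (a : Fin N)
    (ha : h a = 0) : bra η ξ T ω (flipAt h a) =
      (dFun ξ (ξ a - η))⁻¹ • (bra η ξ T ω h ᵥ* T (ξ a) 1 0) := by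
  rw [bra_mul_C hg hT h a ha, smul_smul, inv_mul_cancel₀ (hg.dFun_ne_zero a), one_smul]

lemma bra_mul_D (hg : Generic η ξ) (hT : IsSoVRep η ξ T ω) (h : Fin N → Fin 2) (z : ℂ) :
    bra η ξ T ω h ᵥ* T z 1 1 = (∏ n, (z - shift η ξ h n)) • bra η ξ T ω h := by
  revert z
  induction h using induction_flipAt with
  | h0 => intro z; rw [bra_zero, hT.vac_D]; simp [dFun, shift]
  | hs h a ha ih =>
    have hxa : shift η ξ h a = ξ a := by simp [shift, ha]
    have hxa' : shift η ξ (flipAt h a) a = ξ a - η := by simp [shift, flipAt_self, ha]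
    set v := bra η ξ T ω h with hv
    suffices H : ∀ z, (v ᵥ* T (ξ a) 1 0) ᵥ* T z 1 1 =
        (∏ n, (z - shift η ξ (flipAt h a) n)) • (v ᵥ* T (ξ a) 1 0) by
      intro z
      rw [bra_flipAt hg hT h a ha, Matrix.smul_vecMul, H, smul_comm]
    have hcont : Continuous fun z => (v ᵥ* T (ξ a) 1 0) ᵥ* T z 1 1 := by
      refine continuous_pi fun s => continuous_finsetSum _ fun t _ => ?_
      exact continuous_const.mul (hT.cont t s)
    have hcont' : Continuous fun z =>
        (∏ n, (z - shift η ξ (flipAt h a) n)) • (v ᵥ* T (ξ a) 1 0) := by fun_prop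
    refine fun z => congrFun (hcont.ext_on (dense_compl_singleton (ξ a)) hcont' fun z hz => ?_) z
    have hz' : z - ξ a ≠ 0 := sub_ne_zero.2 hz
    have h0 : v ᵥ* T (ξ a) 1 1 = 0 := by
      rw [ih, Finset.prod_eq_zero (Finset.mem_univ a) (by rw [hxa, sub_self]), zero_smul]
    have key := congrArg (v ᵥ* ·) (hT.rtt z (ξ a) 1 1 1 0)
    simp only [Matrix.vecMul_smul, Matrix.vecMul_sub, ← Matrix.vecMul_vecMul, h0, ih z,
      Matrix.smul_vecMul, Matrix.zero_vecMul] at key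
    have e1 : (∏ n, (z - shift η ξ h n)) =
        (z - ξ a) * ∏ b ∈ Finset.univ.erase a, (z - shift η ξ h b) := by
      rw [← Finset.mul_prod_erase _ _ (Finset.mem_univ a), hxa]
    have e2 : (∏ n, (z - shift η ξ (flipAt h a) n)) =
        (z - ξ a + η) * ∏ b ∈ Finset.univ.erase a, (z - shift η ξ h b) := by
      rw [← Finset.mul_prod_erase _ _ (Finset.mem_univ a), hxa']
      congr 1
      · ring
      · exact Finset.prod_congr rfl fun b hb => by
          rw [shift_flipAt_of_ne _ _ _ (Finset.ne_of_mem_erase hb)]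
    rw [e1] at key
    dsimp only
    rw [e2]
    refine smul_right_injective _ hz' ?_
    dsimp only
    linear_combination (norm := module) -key

lemma bra_mul_C_node (hg : Generic η ξ) (hT : IsSoVRep η ξ T ω) (h : Fin N → Fin 2)
    (a : Fin N) : bra η ξ T ω h ᵥ* T (shift η ξ h a) 1 0 =
      dFun ξ (shift η ξ (flipAt h a) a) • bra η ξ T ω (flipAt h a) := by
  rcases fin_two_eq_zero_or_one (h a) with ha | ha
  · have hxa : shift η ξ h a = ξ a := by simp [shift, ha]
    have hxa' : shift η ξ (flipAt h a) a = ξ a - η := by simp [shift, flipAt_self, ha]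
    rw [hxa, hxa', bra_mul_C hg hT h a ha]
  · have hxa : shift η ξ h a = ξ a - η := by simp [shift, ha]
    have hxa' : shift η ξ (flipAt h a) a = ξ a := by simp [shift, flipAt_self, ha]
    have ha' : flipAt h a a = 0 := by rw [flipAt_self, ha]; rfl
    have e := bra_flipAt hg hT (flipAt h a) a ha'
    rw [flipAt_flipAt] at e
    have hs := hT.sym a 1 0 1 0
    have hs' : T (ξ a) 1 0 * T (ξ a - η) 1 0 = 0 := by
      have : (2 : ℂ) • (T (ξ a) 1 0 * T (ξ a - η) 1 0) = 0 := by
        linear_combination (norm := module) hs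
      exact (smul_eq_zero.1 this).resolve_left two_ne_zero
    rw [hxa, hxa', dFun_self, zero_smul, e, Matrix.smul_vecMul, Matrix.vecMul_vecMul, hs',
      Matrix.vecMul_zero, smul_zero]

lemma bra_mul_B_eq_zero (hg : Generic η ξ) (hT : IsSoVRep η ξ T ω) (h : Fin N → Fin 2) :
    ∀ a, h a = 0 → bra η ξ T ω h ᵥ* T (ξ a) 0 1 = 0 := by
  induction h using induction_flipAt with
  | h0 => intro a _; rw [bra_zero, hT.vac_B]
  | hs h b hb ih =>
    intro a ha
    have hab : a ≠ b := by
      rintro rfl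
      rw [flipAt_self, hb] at ha
      exact absurd ha (by decide)
    have ha' : h a = 0 := by rwa [flipAt, Function.update_of_ne hab] at ha
    set v := bra η ξ T ω h with hv
    have hD : ∀ c, h c = 0 → v ᵥ* T (ξ c) 1 1 = 0 := fun c hc => by
      rw [bra_mul_D hg hT, Finset.prod_eq_zero (Finset.mem_univ c) (by simp [shift, hc]),
        zero_smul]
    have key := congrArg (v ᵥ* ·) (hT.rtt (ξ a) (ξ b) 0 1 1 0)
    simp only [Matrix.vecMul_smul, Matrix.vecMul_sub, ← Matrix.vecMul_vecMul, hD a ha', hD b hb,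
      ih a ha', Matrix.zero_vecMul, sub_zero, smul_zero, zero_sub, smul_neg, neg_eq_zero] at key
    rw [bra_flipAt hg hT h b hb, Matrix.smul_vecMul,
      (smul_eq_zero.1 key).resolve_left (sub_ne_zero.2 (hg.2 a b hab).1), smul_zero]

lemma bra_mul_B_node (hg : Generic η ξ) (hT : IsSoVRep η ξ T ω) (h : Fin N → Fin 2)
    (a : Fin N) : bra η ξ T ω h ᵥ* T (shift η ξ h a) 0 1 =
      (-aFun η ξ (shift η ξ (flipAt h a) a)) • bra η ξ T ω (flipAt h a) := by
  rcases fin_two_eq_zero_or_one (h a) with ha | ha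
  · have hxa : shift η ξ h a = ξ a := by simp [shift, ha]
    have hxa' : shift η ξ (flipAt h a) a = ξ a - η := by simp [shift, flipAt_self, ha]
    rw [hxa, hxa', aFun_self_sub, bra_mul_B_eq_zero hg hT h a ha, neg_zero, zero_smul]
  · have hxa : shift η ξ h a = ξ a - η := by simp [shift, ha]
    have hxa' : shift η ξ (flipAt h a) a = ξ a := by simp [shift, flipAt_self, ha]
    have ha' : flipAt h a a = 0 := by rw [flipAt_self, ha]; rfl
    have e := bra_flipAt hg hT (flipAt h a) a ha'
    rw [flipAt_flipAt] at e
    have hD : bra η ξ T ω (flipAt h a) ᵥ* T (ξ a) 1 1 = 0 := by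
      rw [bra_mul_D hg hT, Finset.prod_eq_zero (Finset.mem_univ a) (by rw [hxa', sub_self]),
        zero_smul]
    have key := congrArg (bra η ξ T ω (flipAt h a) ᵥ* ·) (hT.qdet (ξ a) 1 1 0 0)
    simp only [Matrix.vecMul_smul, Matrix.vecMul_sub, ← Matrix.vecMul_vecMul, hD,
      Matrix.zero_vecMul, Matrix.vecMul_one] at key
    simp at key
    rw [hxa, hxa', e, Matrix.smul_vecMul, Matrix.vecMul_vecMul, ← neg_neg (_ ᵥ* _), key, smul_neg,
      smul_smul, neg_smul]
    congr 2
    field_simp [hg.dFun_ne_zero a]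

/-- The action of an off-diagonal entry on separate covectors, in the basis `bra`. -/
lemma sep_mul_offDiag (hg : Generic η ξ) (hT : IsSoVRep η ξ T ω) {i j : Fin 2} (hij : i ≠ j)
    {φ : ℂ → ℂ} (hφ : ∀ h a, bra η ξ T ω h ᵥ* T (shift η ξ h a) i j =
      φ (shift η ξ (flipAt h a) a) • bra η ξ T ω (flipAt h a)) (P : ℂ[X]) (z : ℂ) :
    sep η ξ T ω P ᵥ* T z i j = ∑ k : Fin N → Fin 2,
      (vdm (shift η ξ k) * ∑ a, φ (shift η ξ k a) * P.eval (shift η ξ (flipAt k a) a) *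
        ∏ b ∈ Finset.univ.erase a, (P.eval (shift η ξ k b) * (z - shift η ξ k b) /
          (shift η ξ k a - shift η ξ k b))) • bra η ξ T ω k := by
  have h1 : ∀ h, bra η ξ T ω h ᵥ* T z i j = ∑ a, ((∏ b ∈ Finset.univ.erase a,
      ((z - shift η ξ h b) / (shift η ξ h a - shift η ξ h b))) *
        φ (shift η ξ (flipAt h a) a)) • bra η ξ T ω (flipAt h a) := by
    intro h
    have hp : ∀ s, IsPolyLT N fun z => (bra η ξ T ω h ᵥ* T z i j) s := fun s =>
      IsPolyLT.sum _ fun t _ => (hT.poly i j hij t s).const_mul _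
    funext s
    rw [(hp s).eq_sum (hg.shift_injective h) z, Finset.sum_apply]
    refine Finset.sum_congr rfl fun a _ => ?_
    rw [hφ]
    simp only [Pi.smul_apply, smul_eq_mul]
    ring
  have hv : ∀ k a, vdm (shift η ξ (flipAt k a)) * ∏ b ∈ Finset.univ.erase a,
      ((z - shift η ξ k b) / (shift η ξ (flipAt k a) a - shift η ξ k b)) =
      vdm (shift η ξ k) * ∏ b ∈ Finset.univ.erase a,
      ((z - shift η ξ k b) / (shift η ξ k a - shift η ξ k b)) := by
    intro k a
    obtain ⟨c, hc⟩ := vdm_update (shift η ξ k) a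
    have e1 := hc (shift η ξ k a)
    rw [Function.update_eq_self] at e1
    have e2 := hc (shift η ξ (flipAt k a) a)
    rw [← shift_flipAt] at e2
    have n1 : ∏ b ∈ Finset.univ.erase a, (shift η ξ k a - shift η ξ k b) ≠ 0 :=
      Finset.prod_ne_zero_iff.2 fun b hb => sub_ne_zero.2 fun h =>
        Finset.ne_of_mem_erase hb (hg.shift_injective k h).symm
    have n2 : ∏ b ∈ Finset.univ.erase a, (shift η ξ (flipAt k a) a - shift η ξ k b) ≠ 0 :=
      Finset.prod_ne_zero_iff.2 fun b hb => sub_ne_zero.2 fun h => by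
        have hne := Finset.ne_of_mem_erase hb
        rw [← shift_flipAt_of_ne η ξ k hne] at h
        exact hne (hg.shift_injective _ h).symm
    rw [e1, e2, Finset.prod_div_distrib, Finset.prod_div_distrib]
    field_simp
  rw [sep, Matrix.sum_vecMul]
  simp only [Matrix.smul_vecMul, h1, Finset.smul_sum, Finset.mul_sum, Finset.sum_smul]
  rw [Finset.sum_comm]
  conv_rhs => rw [Finset.sum_comm]
  refine Finset.sum_congr rfl fun a _ => ?_
  rw [← sum_flipAt a]
  refine Finset.sum_congr rfl fun k _ => ?_
  rw [flipAt_flipAt, smul_smul]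
  congr 1
  have e3 : ∏ b ∈ Finset.univ.erase a, ((z - shift η ξ (flipAt k a) b) /
      (shift η ξ (flipAt k a) a - shift η ξ (flipAt k a) b)) =
      ∏ b ∈ Finset.univ.erase a,
      ((z - shift η ξ k b) / (shift η ξ (flipAt k a) a - shift η ξ k b)) :=
    Finset.prod_congr rfl fun b hb => by
      rw [shift_flipAt_of_ne _ _ _ (Finset.ne_of_mem_erase hb)]
  have e4 : ∏ n, P.eval (shift η ξ (flipAt k a) n) = P.eval (shift η ξ (flipAt k a) a) *
      ∏ b ∈ Finset.univ.erase a, P.eval (shift η ξ k b) := by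
    rw [← Finset.mul_prod_erase _ _ (Finset.mem_univ a)]
    congr 1
    exact Finset.prod_congr rfl fun b hb => by
      rw [shift_flipAt_of_ne _ _ _ (Finset.ne_of_mem_erase hb)]
  have e5 : ∏ b ∈ Finset.univ.erase a, (P.eval (shift η ξ k b) * (z - shift η ξ k b) /
      (shift η ξ k a - shift η ξ k b)) = (∏ b ∈ Finset.univ.erase a, P.eval (shift η ξ k b)) *
      ∏ b ∈ Finset.univ.erase a, ((z - shift η ξ k b) / (shift η ξ k a - shift η ξ k b)) := by
    rw [← Finset.prod_mul_distrib]
    exact Finset.prod_congr rfl fun b _ => mul_div_assoc _ _ _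
  rw [e3, e4, e5]
  linear_combination (φ (shift η ξ k a) * P.eval (shift η ξ (flipAt k a) a) *
    ∏ b ∈ Finset.univ.erase a, P.eval (shift η ξ k b)) * hv k a

end

/-! ### The action of the monodromy matrix on separate covectors -/

lemma eval_rootPoly {ι : Type*} (s : Finset ι) (q : ι → ℂ) (z : ℂ) :
    (rootPoly s q).eval z = ∏ k ∈ s, (z - q k) := by
  simp [rootPoly, eval_prod]

lemma rootPoly_monic {ι : Type*} (s : Finset ι) (q : ι → ℂ) : (rootPoly s q).Monic :=
  monic_prod_of_monic _ _ fun _ _ => monic_X_sub_C _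

lemma natDegree_rootPoly {ι : Type*} (s : Finset ι) (q : ι → ℂ) :
    (rootPoly s q).natDegree = s.card := by
  simp [rootPoly]

section

variable {N : ℕ} {S : Type*} [Fintype S] [DecidableEq S] {η : ℂ} {ξ : Fin N → ℂ}
  {T : ℂ → Matrix (Fin 2) (Fin 2) (Matrix S S ℂ)} {ω : S → ℂ}

lemma dFun_mul_eval_flipAt (P : ℂ[X]) (k : Fin N → Fin 2) (a : Fin N) :
    dFun ξ (shift η ξ k a) * P.eval (shift η ξ (flipAt k a) a) =
      dFun ξ (shift η ξ k a) * P.eval (shift η ξ k a + η) := by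
  rcases fin_two_eq_zero_or_one (k a) with ha | ha
  · have hxa : shift η ξ k a = ξ a := by simp [shift, ha]
    rw [hxa, dFun_self, zero_mul, zero_mul]
  · have hxa : shift η ξ k a + η = shift η ξ (flipAt k a) a := by simp [shift, flipAt_self, ha]
    rw [hxa]

lemma aFun_mul_eval_flipAt (P : ℂ[X]) (k : Fin N → Fin 2) (a : Fin N) :
    aFun η ξ (shift η ξ k a) * P.eval (shift η ξ (flipAt k a) a) =
      aFun η ξ (shift η ξ k a) * P.eval (shift η ξ k a - η) := by
  rcases fin_two_eq_zero_or_one (k a) with ha | ha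
  · have hxa : shift η ξ k a - η = shift η ξ (flipAt k a) a := by simp [shift, flipAt_self, ha]
    rw [hxa]
  · have hxa : shift η ξ k a = ξ a - η := by simp [shift, ha]
    rw [hxa, aFun_self_sub, zero_mul, zero_mul]

lemma sep_mul_D (hg : Generic η ξ) (hT : IsSoVRep η ξ T ω) {κ : Type*} [DecidableEq κ]
    (q : κ → ℂ) {s : Finset κ} {p₀ : κ} (hp : p₀ ∉ s) :
    sep η ξ T ω (rootPoly s q) ᵥ* T (q p₀) 1 1 =
      (-1 : ℂ) ^ N • sep η ξ T ω (rootPoly (insert p₀ s) q) := by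
  rw [sep, sep, Matrix.sum_vecMul, Finset.smul_sum]
  refine Finset.sum_congr rfl fun h _ => ?_
  rw [Matrix.smul_vecMul, bra_mul_D hg hT, smul_smul, smul_smul]
  congr 1
  have e : ∏ n, (q p₀ - shift η ξ h n) = (-1) ^ N * ∏ n, (shift η ξ h n - q p₀) := by
    simpa using Finset.prod_neg (s := Finset.univ) (fun n => shift η ξ h n - q p₀)
  simp only [eval_rootPoly, Finset.prod_insert hp, Finset.prod_mul_distrib, e]
  ring

lemma sep_mul_offDiag_eq_sum (hg : Generic η ξ) (hT : IsSoVRep η ξ T ω) {i j : Fin 2}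
    (hij : i ≠ j) {φ : ℂ → ℂ} (hφ : ∀ h a, bra η ξ T ω h ᵥ* T (shift η ξ h a) i j =
      φ (shift η ξ (flipAt h a) a) • bra η ξ T ω (flipAt h a)) {κ : Type*} [DecidableEq κ]
    {q : κ → ℂ} {s : Finset κ} {p₀ : κ} (hp : p₀ ∉ s)
    (hq : Set.InjOn q (insert p₀ s : Finset κ)) (c : ℂ) {F : ℂ[X]} (hF : F.Monic)
    (hFd : F.natDegree = N + s.card) (hFe : ∀ k a, φ (shift η ξ k a) *
      (rootPoly s q).eval (shift η ξ (flipAt k a) a) = c * F.eval (shift η ξ k a)) :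
    sep η ξ T ω (rootPoly s q) ᵥ* T (q p₀) i j =
      c • (-((-1 : ℂ) ^ N • sep η ξ T ω (rootPoly (insert p₀ s) q)) +
        ∑ p ∈ insert p₀ s, (F.eval (q p) / ∏ k ∈ (insert p₀ s).erase p, (q p - q k)) •
          sep η ξ T ω (rootPoly ((insert p₀ s).erase p) q)) := by
  rw [sep_mul_offDiag hg hT hij hφ]
  have h1 : ∀ k : Fin N → Fin 2, ∑ a, φ (shift η ξ k a) *
      (rootPoly s q).eval (shift η ξ (flipAt k a) a) *
        ∏ b ∈ Finset.univ.erase a, ((rootPoly s q).eval (shift η ξ k b) *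
          (q p₀ - shift η ξ k b) / (shift η ξ k a - shift η ξ k b)) =
      c * (-((-1) ^ N * ∏ b, (rootPoly (insert p₀ s) q).eval (shift η ξ k b)) +
        ∑ p ∈ insert p₀ s, F.eval (q p) / (∏ k ∈ (insert p₀ s).erase p, (q p - q k)) *
          ∏ b, (rootPoly ((insert p₀ s).erase p) q).eval (shift η ξ k b)) := by
    intro k
    simp only [eval_rootPoly]
    rw [← sum_residues (hg.shift_injective k) hq hF (by
      rw [hFd, Finset.card_insert_of_notMem hp]; ring), Finset.mul_sum]
    refine Finset.sum_congr rfl fun a _ => ?_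
    rw [← eval_rootPoly, hFe, mul_assoc]
    congr 2
    refine Finset.prod_congr rfl fun b _ => ?_
    rw [Finset.prod_insert hp]
    ring
  simp only [h1]
  simp only [sep, Finset.smul_sum, smul_add, smul_neg, smul_smul]
  rw [Finset.sum_comm, ← Finset.sum_neg_distrib, ← Finset.sum_add_distrib]
  refine Finset.sum_congr rfl fun k _ => ?_
  rw [← Finset.sum_smul, ← neg_smul, ← add_smul]
  congr 1
  rw [mul_add, mul_add, Finset.mul_sum, Finset.mul_sum]
  congr 1
  · ring
  · exact Finset.sum_congr rfl fun p _ => by ring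

lemma rootPoly_mul_comp_monic {κ : Type*} (s : Finset κ) (q : κ → ℂ) (x : Fin N → ℂ) (c : ℂ) :
    (rootPoly Finset.univ x * (rootPoly s q).comp (X + C c)).Monic :=
  (rootPoly_monic _ _).mul ((rootPoly_monic _ _).comp (monic_X_add_C c) (by simp))

lemma natDegree_rootPoly_mul_comp {κ : Type*} (s : Finset κ) (q : κ → ℂ) (x : Fin N → ℂ) (c : ℂ) :
    (rootPoly Finset.univ x * (rootPoly s q).comp (X + C c)).natDegree = N + s.card := by
  rw [(rootPoly_monic _ _).natDegree_mul
    ((rootPoly_monic _ _).comp (monic_X_add_C c) (by simp)), natDegree_comp, natDegree_rootPoly,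
    natDegree_rootPoly]
  simp

lemma sep_mul_C (hg : Generic η ξ) (hT : IsSoVRep η ξ T ω) {κ : Type*} [DecidableEq κ]
    {q : κ → ℂ} {s : Finset κ} {p₀ : κ} (hp : p₀ ∉ s)
    (hq : Set.InjOn q (insert p₀ s : Finset κ)) :
    sep η ξ T ω (rootPoly s q) ᵥ* T (q p₀) 1 0 =
      -((-1 : ℂ) ^ N • sep η ξ T ω (rootPoly (insert p₀ s) q)) +
        ∑ p ∈ insert p₀ s, (dFun ξ (q p) * (∏ k ∈ s, (q p - q k + η)) /
          ∏ k ∈ (insert p₀ s).erase p, (q p - q k)) •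
          sep η ξ T ω (rootPoly ((insert p₀ s).erase p) q) := by
  have he : ∀ z, (rootPoly Finset.univ ξ * (rootPoly s q).comp (X + C η)).eval z =
      dFun ξ z * ∏ k ∈ s, (z - q k + η) := fun z => by
    simp only [eval_mul, eval_comp, eval_rootPoly, dFun, eval_add, eval_X, eval_C,
      add_sub_right_comm]
  rw [sep_mul_offDiag_eq_sum hg hT (by decide) (bra_mul_C_node hg hT) hp hq 1
    (rootPoly_mul_comp_monic s q ξ η) (natDegree_rootPoly_mul_comp s q ξ η) fun k a => by
      rw [dFun_mul_eval_flipAt, one_mul, he, eval_rootPoly]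
      simp only [add_sub_right_comm], one_smul]
  simp only [he]

lemma sep_mul_B (hg : Generic η ξ) (hT : IsSoVRep η ξ T ω) {κ : Type*} [DecidableEq κ]
    {q : κ → ℂ} {s : Finset κ} {p₀ : κ} (hp : p₀ ∉ s)
    (hq : Set.InjOn q (insert p₀ s : Finset κ)) :
    sep η ξ T ω (rootPoly s q) ᵥ* T (q p₀) 0 1 =
      (-1 : ℂ) ^ N • sep η ξ T ω (rootPoly (insert p₀ s) q) +
        ∑ p ∈ insert p₀ s, (-(aFun η ξ (q p) * (∏ k ∈ s, (q k - q p + η)) /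
          ∏ k ∈ (insert p₀ s).erase p, (q k - q p))) •
          sep η ξ T ω (rootPoly ((insert p₀ s).erase p) q) := by
  have he : ∀ z, (rootPoly Finset.univ (fun n => ξ n - η) *
      (rootPoly s q).comp (X + C (-η))).eval z = aFun η ξ z * ∏ k ∈ s, (z - η - q k) :=
    fun z => by
      simp only [eval_mul, eval_comp, eval_rootPoly, aFun, eval_add, eval_X, eval_C,
        ← sub_eq_add_neg, sub_add]
  rw [sep_mul_offDiag_eq_sum hg hT (φ := fun z => -aFun η ξ z) (by decide)
    (bra_mul_B_node hg hT) hp hq (-1) (rootPoly_mul_comp_monic s q _ _)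
    (natDegree_rootPoly_mul_comp s q _ _) fun k a => by
      rw [neg_mul, aFun_mul_eval_flipAt, neg_one_mul, he, eval_rootPoly], neg_one_smul, neg_add,
      neg_neg, ← Finset.sum_neg_distrib]
  congr 1
  refine Finset.sum_congr rfl fun p hps => ?_
  rw [← neg_smul, he]
  congr 2
  have e1 : ∏ k ∈ s, (q k - q p + η) = (-1) ^ s.card * ∏ k ∈ s, (q p - η - q k) := by
    rw [← Finset.prod_neg]
    exact Finset.prod_congr rfl fun k _ => by ring
  have e2 : ∏ k ∈ (insert p₀ s).erase p, (q k - q p) =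
      (-1) ^ s.card * ∏ k ∈ (insert p₀ s).erase p, (q p - q k) := by
    have : s.card = ((insert p₀ s).erase p).card := by
      rw [Finset.card_erase_of_mem hps, Finset.card_insert_of_notMem hp]; rfl
    rw [this, ← Finset.prod_neg]
    exact Finset.prod_congr rfl fun k _ => by ring
  rw [e1, e2, mul_left_comm, mul_div_mul_left _ _ (pow_ne_zero _ (by norm_num))]

/-- Separate covectors of solutions of the functional `T`-`Q` equation are eigenvectors of the
twisted transfer matrix. -/
lemma sep_mul_twist (hg : Generic η ξ) (hT : IsSoVRep η ξ T ω) {Q : ℂ[X]} {τ : ℂ → ℂ}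
    (hτ : IsPolyLT N τ)
    (hTQ : ∀ z, τ z * Q.eval z = -(aFun η ξ z * Q.eval (z - η)) + dFun ξ z * Q.eval (z + η))
    (z : ℂ) : sep η ξ T ω Q ᵥ* twist T z = τ z • sep η ξ T ω Q := by
  rw [twist, Matrix.vecMul_add, sep_mul_offDiag hg hT (by decide) (bra_mul_C_node hg hT),
    sep_mul_offDiag hg hT (φ := fun z => -aFun η ξ z) (by decide) (bra_mul_B_node hg hT),
    ← Finset.sum_add_distrib]
  conv_rhs => rw [sep, Finset.smul_sum]
  refine Finset.sum_congr rfl fun k _ => ?_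
  rw [← add_smul, smul_smul, ← mul_add, ← Finset.sum_add_distrib]
  congr 1
  rw [hτ.eq_sum (hg.shift_injective k) z, ← mul_assoc, mul_comm (vdm _)]
  congr 1
  rw [Finset.sum_mul]
  refine Finset.sum_congr rfl fun a _ => ?_
  rw [neg_mul, aFun_mul_eval_flipAt, dFun_mul_eval_flipAt, ← add_mul, ← hTQ,
    ← Finset.mul_prod_erase _ _ (Finset.mem_univ a)]
  simp only [mul_div_assoc, Finset.prod_mul_distrib]
  ring

/-- At an inhomogeneity the rows of the monodromy matrix are related in the same way. -/
lemma vecMul_B_eq_vecMul_A (hg : Generic η ξ) (hT : IsSoVRep η ξ T ω) {n : Fin N}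
    {φ ψ : S → ℂ} (h : ψ ᵥ* T (ξ n) 1 1 = φ ᵥ* T (ξ n) 1 0) :
    ψ ᵥ* T (ξ n) 0 1 = φ ᵥ* T (ξ n) 0 0 := by
  have hδ : aFun η ξ (ξ n) * dFun ξ (ξ n - η) ≠ 0 :=
    mul_ne_zero (hg.aFun_ne_zero n) (hg.dFun_ne_zero n)
  have hq : T (ξ n - η) 1 1 * T (ξ n) 0 0 - T (ξ n - η) 0 1 * T (ξ n) 1 0 =
      (aFun η ξ (ξ n) * dFun ξ (ξ n - η)) • (1 : Matrix S S ℂ) := by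
    have h1 := hT.rtt (ξ n - η) (ξ n) 1 1 0 0
    rw [sub_sub_cancel_left, neg_smul, ← smul_neg] at h1
    have h2 := smul_right_injective _ hg.1 h1
    have h3 := hT.qdet (ξ n) 0 0 1 1
    norm_num at h3
    linear_combination (norm := module) h3 - h2
  have hself : ∀ l, T (ξ n) 0 l * T (ξ n - η) 0 1 = 0 := fun l => by
    have hs := hT.sym n 0 l 0 1
    have : (2 : ℂ) • (T (ξ n) 0 l * T (ξ n - η) 0 1) = 0 := by
      linear_combination (norm := module) hs
    exact (smul_eq_zero.1 this).resolve_left two_ne_zero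
  set u := ψ ᵥ* T (ξ n) 0 1 - φ ᵥ* T (ξ n) 0 0 with hu
  have hB : u ᵥ* T (ξ n - η) 0 1 = 0 := by
    rw [hu, Matrix.sub_vecMul, Matrix.vecMul_vecMul, Matrix.vecMul_vecMul, hself, hself]
    simp
  have hD : u ᵥ* T (ξ n - η) 1 1 = 0 := by
    have s1 := eq_neg_of_add_eq_zero_left (hT.sym n 0 1 1 1)
    have s2 := eq_neg_of_add_eq_zero_left (hT.sym n 0 0 1 1)
    rw [hu, Matrix.sub_vecMul, Matrix.vecMul_vecMul, Matrix.vecMul_vecMul, s1, s2,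
      Matrix.vecMul_neg, Matrix.vecMul_neg, ← Matrix.vecMul_vecMul, ← Matrix.vecMul_vecMul, h]
    simp
  have := congrArg (u ᵥ* ·) hq
  simp only [Matrix.vecMul_sub, ← Matrix.vecMul_vecMul, hB, hD, Matrix.zero_vecMul,
    Matrix.vecMul_smul, Matrix.vecMul_one, sub_zero] at this
  exact sub_eq_zero.1 ((smul_eq_zero.1 this.symm).resolve_left hδ)

end

/-! ### The chain -/

section

variable {N : ℕ}

lemma elemAt_mulVec (n : Fin N) (i j : Fin 2) (v : (Fin N → Fin 2) → ℂ) (s : Fin N → Fin 2) :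
    (elemAt n i j *ᵥ v) s = if s n = i then v (Function.update s n j) else 0 := by
  have h : ∀ t, (s n = i ∧ t n = j ∧ ∀ k, k ≠ n → s k = t k) ↔
      (s n = i ∧ t = Function.update s n j) := by
    refine fun t => and_congr_right fun _ => ⟨fun ⟨h1, h2⟩ => funext fun k => ?_, ?_⟩
    · by_cases hk : k = n
      · subst hk; simp [h1]
      · simp [hk, h2 k hk]
    · rintro rfl
      exact ⟨by simp, fun k hk => by simp [hk]⟩
  simp only [Matrix.mulVec, dotProduct, elemAt, Matrix.of_apply, h, ite_mul, one_mul, zero_mul]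
  split_ifs with hs <;> simp [hs]

lemma isMatrixUnits_elemAt (n : Fin N) : IsMatrixUnits (elemAt n) where
  mul i j k l := by
    refine Matrix.ext_of_mulVec_single fun t => funext fun s => ?_
    rw [← Matrix.mulVec_mulVec, elemAt_mulVec, elemAt_mulVec]
    split_ifs <;> simp_all [elemAt_mulVec]
  one := by
    refine Matrix.ext_of_mulVec_single fun t => funext fun s => ?_
    rw [Matrix.add_mulVec, Pi.add_apply, elemAt_mulVec, elemAt_mulVec, Matrix.one_mulVec]
    rcases fin_two_eq_zero_or_one (s n) with h | h <;> simp [h] <;> simp [← h]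

lemma elemAt_commute {n k : Fin N} (hnk : n ≠ k) (i j i' j' : Fin 2) :
    elemAt n i j * elemAt k i' j' = elemAt k i' j' * elemAt n i j := by
  refine Matrix.ext_of_mulVec_single fun t => funext fun s => ?_
  rw [← Matrix.mulVec_mulVec, ← Matrix.mulVec_mulVec, elemAt_mulVec, elemAt_mulVec, elemAt_mulVec,
    elemAt_mulVec, Function.update_of_ne hnk, Function.update_of_ne hnk.symm,
    Function.update_comm hnk]
  split_ifs <;> rfl

lemma elemAt_transpose (n : Fin N) (i j : Fin 2) : (elemAt n i j)ᵀ = elemAt n j i := by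
  ext s t
  simp only [elemAt, Matrix.transpose_apply, Matrix.of_apply]
  congr 1
  apply propext
  constructor <;> rintro ⟨h1, h2, h3⟩ <;> exact ⟨h2, h1, fun k hk => (h3 k hk).symm⟩

/-- The covector `⟨0|`. -/
def vacuum (N : ℕ) : (Fin N → Fin 2) → ℂ := Pi.single (fun _ => 0) 1

lemma vacuum_vecMul_elemAt_one (n : Fin N) (j : Fin 2) : vacuum N ᵥ* elemAt n 1 j = 0 := by
  rw [← elemAt_transpose, Matrix.vecMul_transpose]
  funext s
  rw [elemAt_mulVec, vacuum, Pi.single_apply]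
  split_ifs with h1 h2
  · exact absurd (congrFun h2 n) (by simp)
  · rfl
  · rfl

/-- The Lax matrix of a site. -/
def siteLax (η : ℂ) (ξ : Fin N → ℂ) (n : Fin N) :
    ℂ → Matrix (Fin 2) (Fin 2) (Matrix (Fin N → Fin 2) (Fin N → Fin 2) ℂ) :=
  lax η (ξ n) (elemAt n)

/-- The product of the Lax matrices over a list of sites. -/
def chain (η : ℂ) (ξ : Fin N → ℂ) (l : List (Fin N)) (z : ℂ) :
    Matrix (Fin 2) (Fin 2) (Matrix (Fin N → Fin 2) (Fin N → Fin 2) ℂ) :=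
  (l.map fun n => siteLax η ξ n z).prod

variable {η : ℂ} {ξ : Fin N → ℂ}

lemma chain_cons (n : Fin N) (l : List (Fin N)) :
    chain η ξ (n :: l) = fun z => siteLax η ξ n z * chain η ξ l z := by
  funext z; simp [chain]

lemma chain_append (l l' : List (Fin N)) :
    chain η ξ (l ++ l') = fun z => chain η ξ l z * chain η ξ l' z := by
  funext z; simp [chain]

lemma chain_nil : chain η ξ [] = fun _ => 1 := by
  funext z; simp [chain]

lemma chain_singleton (n : Fin N) : chain η ξ [n] = siteLax η ξ n := by
  funext z; simp [chain]

lemma siteLax_comm_elemAt {n k : Fin N} (hnk : n ≠ k) (z : ℂ) (i j i' j' : Fin 2) :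
    siteLax η ξ n z i j * elemAt k i' j' = elemAt k i' j' * siteLax η ξ n z i j := by
  simp [siteLax, lax, add_mul, mul_add, elemAt_commute hnk]

lemma chain_comm_elemAt {l : List (Fin N)} {k : Fin N} (hk : k ∉ l) (z : ℂ) (i j i' j' : Fin 2) :
    chain η ξ l z i j * elemAt k i' j' = elemAt k i' j' * chain η ξ l z i j := by
  induction l generalizing i j with
  | nil => rw [chain_nil]; fin_cases i <;> fin_cases j <;> simp
  | cons n l ih =>
    simp only [List.mem_cons, not_or] at hk
    simp only [chain_cons, Matrix.mul_apply, Finset.sum_mul, Finset.mul_sum]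
    refine Finset.sum_congr rfl fun p _ => ?_
    rw [mul_assoc, ih hk.2, ← mul_assoc, siteLax_comm_elemAt (Ne.symm hk.1), mul_assoc]

lemma siteLax_entriesCommute {n : Fin N}
    {T : ℂ → Matrix (Fin 2) (Fin 2) (Matrix (Fin N → Fin 2) (Fin N → Fin 2) ℂ)}
    (h : ∀ z i j k l, T z i j * elemAt n k l = elemAt n k l * T z i j) :
    EntriesCommute (siteLax η ξ n) T := by
  intro x y i j k l
  simp [siteLax, lax, add_mul, mul_add, h]

lemma siteLax_comm_chain {n : Fin N} {l : List (Fin N)} (hn : n ∉ l) :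
    EntriesCommute (siteLax η ξ n) (chain η ξ l) :=
  siteLax_entriesCommute fun z i j k l => chain_comm_elemAt hn z i j k l

lemma chain_comm_chain {l l' : List (Fin N)} (h : ∀ n ∈ l, n ∉ l') :
    EntriesCommute (chain η ξ l) (chain η ξ l') := by
  induction l with
  | nil => intro x y i j k l; rw [chain_nil]; fin_cases i <;> fin_cases j <;> simp
  | cons n l ih =>
    have h1 := ih fun k hk => h k (by simp [hk])
    have h2 := siteLax_comm_chain (η := η) (ξ := ξ) (h n (by simp))
    intro x y i j k l
    simp only [chain_cons, Matrix.mul_apply, Finset.sum_mul, Finset.mul_sum]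
    refine Finset.sum_congr rfl fun p _ => ?_
    rw [mul_assoc, h1, ← mul_assoc, h2, mul_assoc]

lemma chain_isRTT {l : List (Fin N)} (hl : l.Nodup) : IsRTT η (chain η ξ l) := by
  induction l with
  | nil =>
    intro x y i j k l
    rw [chain_nil]
    fin_cases i <;> fin_cases j <;> fin_cases k <;> fin_cases l <;> simp
  | cons n l ih =>
    rw [List.nodup_cons] at hl
    rw [chain_cons]
    exact (lax_isRTT η (ξ n) (isMatrixUnits_elemAt n)).mul (ih hl.2) (siteLax_comm_chain hl.1)

lemma chain_hasQDet {l : List (Fin N)} (hl : l.Nodup) :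
    HasQDet η (chain η ξ l) (fun z => (l.map fun n => (z - ξ n + η) * (z - η - ξ n)).prod) := by
  induction l with
  | nil =>
    intro x i j k l
    rw [chain_nil]
    fin_cases i <;> fin_cases j <;> fin_cases k <;> fin_cases l <;> simp
  | cons n l ih =>
    rw [List.nodup_cons] at hl
    rw [chain_cons]
    simp only [List.map_cons, List.prod_cons]
    exact (lax_hasQDet η (ξ n) (isMatrixUnits_elemAt n)).mul (ih hl.2) (siteLax_comm_chain hl.1)

lemma chain_symVanish (hη : η ≠ 0) {l : List (Fin N)} (hl : l.Nodup) {n : Fin N} (hn : n ∈ l) :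
    SymVanish η (chain η ξ l) (ξ n) := by
  induction l with
  | nil => simp at hn
  | cons k l ih =>
    rw [List.nodup_cons] at hl
    rw [chain_cons]
    by_cases h : n = k
    · subst h
      exact (lax_symVanish η (ξ n) (isMatrixUnits_elemAt n)).mul_left (siteLax_comm_chain hl.1)
    · exact SymVanish.mul_right hη (lax_isRTT η (ξ k) (isMatrixUnits_elemAt k))
        (ih hl.2 (by simpa [h] using hn)) (siteLax_comm_chain hl.1)

lemma siteLax_mul_apply (n : Fin N)
    (M : Matrix (Fin 2) (Fin 2) (Matrix (Fin N → Fin 2) (Fin N → Fin 2) ℂ)) (z : ℂ) (i j : Fin 2) :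
    (siteLax η ξ n z * M) i j =
      (z - ξ n) • M i j + ∑ p, η • (elemAt n p i * M p j) := by
  simp only [Matrix.mul_apply, siteLax, lax, Matrix.of_apply, add_mul, smul_mul_assoc, one_mul,
    Finset.sum_add_distrib]
  congr 1
  simp [ite_smul]

lemma chain_poly (l : List (Fin N)) (i j : Fin 2) (s t : Fin N → Fin 2) :
    IsPolyLT (if i = j then l.length + 1 else l.length) (fun z => chain η ξ l z i j s t) := by
  induction l generalizing i j s t with
  | nil =>
    rw [chain_nil]
    by_cases h : i = j
    · subst h
      simp only [Matrix.one_apply_eq, if_true, List.length_nil]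
      simpa using IsPolyLT.one.const_mul ((1 : Matrix (Fin N → Fin 2) (Fin N → Fin 2) ℂ) s t)
    · simpa [h] using IsPolyLT.zero 0
  | cons n l ih =>
    simp only [chain_cons, siteLax_mul_apply]
    simp only [Matrix.add_apply, Matrix.smul_apply, Matrix.sum_apply, Matrix.mul_apply,
      smul_eq_mul]
    have h1 : ∀ p u, IsPolyLT (l.length + 1) (fun z => chain η ξ l z p j u t) := fun p u =>
      (ih p j u t).mono (by split_ifs <;> simp)
    refine IsPolyLT.add ?_ ?_
    · have := (ih i j s t).sub_mul (ξ n)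
      refine this.mono ?_
      split_ifs <;> simp
    · refine IsPolyLT.sum _ fun p _ => IsPolyLT.const_mul (IsPolyLT.sum _ fun u _ => ?_) _
      refine ((h1 p u).const_mul _).mono ?_
      split_ifs <;> simp

lemma vacuum_chain {l : List (Fin N)} (hl : l.Nodup) (z : ℂ) :
    vacuum N ᵥ* chain η ξ l z 0 1 = 0 ∧
      vacuum N ᵥ* chain η ξ l z 1 1 = (l.map fun n => z - ξ n).prod • vacuum N := by
  induction l with
  | nil => simp [chain_nil]
  | cons n l ih =>
    rw [List.nodup_cons] at hl
    obtain ⟨h1, h2⟩ := ih hl.2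
    simp only [chain_cons, siteLax_mul_apply, Matrix.vecMul_add, Matrix.vecMul_smul,
      Fin.sum_univ_two, h1, h2]
    constructor
    · rw [← chain_comm_elemAt hl.1, ← Matrix.vecMul_vecMul, h1, ← Matrix.vecMul_vecMul,
        vacuum_vecMul_elemAt_one]
      simp
    · rw [← chain_comm_elemAt hl.1, ← Matrix.vecMul_vecMul, h1, ← Matrix.vecMul_vecMul,
        vacuum_vecMul_elemAt_one]
      simp [smul_smul]

lemma chain_isSoVRep (hη : η ≠ 0) {l : List (Fin N)} (hl : l.Nodup) (hl' : ∀ n, n ∈ l) :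
    IsSoVRep η ξ (chain η ξ l) (vacuum N) := by
  have huniv : l.toFinset = Finset.univ := by ext n; simp [hl']
  have hprod : ∀ f : Fin N → ℂ, (l.map f).prod = ∏ n, f n := fun f => by
    rw [← List.prod_toFinset f hl, huniv]
  have hlen : l.length = N := by
    rw [← List.toFinset_card_of_nodup hl, huniv, Finset.card_univ, Fintype.card_fin]
  refine ⟨chain_isRTT hl, ?_, fun n => chain_symVanish hη hl (hl' n), fun i j hij s t => ?_,
    fun s t => (chain_poly l 1 1 s t).continuous, fun z => (vacuum_chain hl z).1,
    fun z => ?_⟩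
  · have := chain_hasQDet (η := η) (ξ := ξ) hl
    simp only [hprod, Finset.prod_mul_distrib] at this
    exact this
  · have := chain_poly (η := η) (ξ := ξ) l i j s t
    rwa [if_neg hij, hlen] at this
  · rw [(vacuum_chain hl z).2, hprod, dFun]

lemma chain_transpose (l : List (Fin N)) (z : ℂ) (i j : Fin 2) :
    (chain η ξ l z i j)ᵀ = chain η ξ l.reverse z j i := by
  have h0 : ∀ n i j, (siteLax η ξ n z i j)ᵀ = siteLax η ξ n z j i := fun n i j => by
    by_cases h : i = j
    · subst h; simp [siteLax, lax, elemAt_transpose]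
    · simp [siteLax, lax, elemAt_transpose, h, Ne.symm h]
  induction l generalizing i j with
  | nil => by_cases h : i = j <;> simp [chain_nil, h, Ne.symm]
  | cons n l ih =>
    rw [List.reverse_cons, chain_append, chain_singleton]
    simp only [chain_cons, Matrix.mul_apply, Matrix.transpose_sum, Matrix.transpose_mul, ih, h0]

/-! ### Identification with the monodromy matrix -/

lemma rSite_eq_comp (n : Fin N) (z : ℂ) :
    rSite η n (z - ξ n) = Matrix.compRingEquiv (Fin 2) (Fin N → Fin 2) ℂ (siteLax η ξ n z) := by
  ext ⟨i, s⟩ ⟨j, t⟩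
  simp only [rSite, Matrix.of_apply, Matrix.compRingEquiv_apply, Matrix.comp_apply, siteLax, lax,
    rMatrix, Matrix.add_apply, Matrix.smul_apply, elemAt, smul_eq_mul, Matrix.one_apply,
    Prod.mk.injEq]
  have hst : s = t ↔ s n = t n ∧ ∀ k, k ≠ n → s k = t k :=
    ⟨by rintro rfl; simp, fun ⟨h1, h2⟩ => funext fun k => by
      by_cases hk : k = n
      · rw [hk, h1]
      · exact h2 k hk⟩
  simp only [hst]
  by_cases hk : ∀ k, k ≠ n → s k = t k
  · rw [if_pos hk]
    simp only [and_iff_left hk]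
    rcases fin_two_eq_zero_or_one (s n) with hs | hs <;>
      rcases fin_two_eq_zero_or_one (t n) with ht | ht <;>
        fin_cases i <;> fin_cases j <;> simp [hs, ht]
  · simp [hk]

lemma monodromyEntry_eq_chain (i j : Fin 2) (z : ℂ) :
    monodromyEntry η ξ i j z = chain η ξ (List.finRange N).reverse z i j := by
  have h : monodromy η ξ z = Matrix.compRingEquiv (Fin 2) (Fin N → Fin 2) ℂ
      (chain η ξ (List.finRange N).reverse z) := by
    simp only [monodromy, chain, map_list_prod, List.map_map, List.ofFn_eq_map, ← List.map_reverse,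
      rSite_eq_comp]
    rfl
  ext s t
  simp only [monodromyEntry, Matrix.of_apply, h]
  rfl

lemma sovBra_eq_bra (h : Fin N → Fin 2) :
    sovBra η ξ h = bra η ξ (chain η ξ (List.finRange N).reverse) (vacuum N) h := by
  simp only [sovBra, opC, monodromyEntry_eq_chain, bra, vacuum]

lemma sepBra_eq_sep (P : ℂ[X]) :
    sepBra η ξ P = sep η ξ (chain η ξ (List.finRange N).reverse) (vacuum N) P := by
  simp only [sepBra, sovBra_eq_bra, sep]

end

/-! ### Separate vectors -/

section

variable {N : ℕ} {η : ℂ} {ξ : Fin N → ℂ}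

lemma vdm_shift_flipAt (h : Fin N → Fin 2) (a : Fin N) :
    vdm (shift η ξ (flipAt h a)) *
        ∏ b ∈ Finset.univ.erase a, (shift η ξ h a - shift η ξ h b) =
      vdm (shift η ξ h) *
        ∏ b ∈ Finset.univ.erase a, (shift η ξ (flipAt h a) a - shift η ξ h b) := by
  obtain ⟨c, hc⟩ := vdm_update (shift η ξ h) a
  have e1 := hc (shift η ξ h a)
  rw [Function.update_eq_self] at e1
  have e2 := hc (shift η ξ (flipAt h a) a)
  rw [← shift_flipAt] at e2
  rw [e1, e2]
  ring

lemma Generic.prod_shift_sub_ne_zero (hg : Generic η ξ) (h : Fin N → Fin 2) (a : Fin N) :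
    ∏ b ∈ Finset.univ.erase a, (shift η ξ h a - shift η ξ h b) ≠ 0 :=
  Finset.prod_ne_zero_iff.2 fun _ hb => sub_ne_zero.2 fun e =>
    Finset.ne_of_mem_erase hb (hg.shift_injective h e).symm

lemma vdm_shift_compl (hg : Generic η ξ) (h : Fin N → Fin 2) :
    (∏ n, if h n = 1 then -(aFun η ξ (ξ n))⁻¹ * dFun ξ (ξ n - η) else 1) *
      vdm (shift η ξ fun n => 1 - h n) = vdm (shift η ξ h) := by
  induction h using induction_flipAt with
  | h0 => simp [vdm, shift]
  | hs h a ha ih =>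
    have hy : (fun n => 1 - flipAt h a n) = flipAt (fun n => 1 - h n) a := by
      funext n
      by_cases hn : n = a
      · subst hn; simp [flipAt_self]
      · simp [flipAt, hn]
    set y : Fin N → Fin 2 := fun n => 1 - h n with hyd
    have hya : y a = 1 := by simp [hyd, ha]
    have hP : (∏ n, if flipAt h a n = 1 then -(aFun η ξ (ξ n))⁻¹ * dFun ξ (ξ n - η) else 1) =
        (-(aFun η ξ (ξ a))⁻¹ * dFun ξ (ξ a - η)) *
        ∏ n, if h n = 1 then -(aFun η ξ (ξ n))⁻¹ * dFun ξ (ξ n - η) else 1 := by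
      rw [← Finset.mul_prod_erase _ _ (Finset.mem_univ a),
        ← Finset.mul_prod_erase _ (fun n => if h n = 1 then _ else _) (Finset.mem_univ a)]
      have : ∏ n ∈ Finset.univ.erase a,
          (if flipAt h a n = 1 then -(aFun η ξ (ξ n))⁻¹ * dFun ξ (ξ n - η) else 1) =
          ∏ n ∈ Finset.univ.erase a,
          (if h n = 1 then -(aFun η ξ (ξ n))⁻¹ * dFun ξ (ξ n - η) else 1) :=
        Finset.prod_congr rfl fun n hn => by
          rw [flipAt, Function.update_of_ne (Finset.ne_of_mem_erase hn)]
      rw [this]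
      simp [flipAt_self, ha]
    have hA : aFun η ξ (ξ a) = η * ∏ b ∈ Finset.univ.erase a, (ξ a - ξ b + η) := by
      rw [aFun, ← Finset.mul_prod_erase _ _ (Finset.mem_univ a), sub_self, zero_add]
    have hD : dFun ξ (ξ a - η) = -η * ∏ b ∈ Finset.univ.erase a, (ξ a - η - ξ b) := by
      rw [dFun, ← Finset.mul_prod_erase _ _ (Finset.mem_univ a), sub_sub_cancel_left]
    have hA0 : ∏ b ∈ Finset.univ.erase a, (ξ a - ξ b + η) ≠ 0 := fun h0 =>
      hg.aFun_ne_zero a (by rw [hA, h0, mul_zero])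
    have v1 := vdm_shift_flipAt (η := η) (ξ := ξ) h a
    have v2 := vdm_shift_flipAt (η := η) (ξ := ξ) y a
    have hX := hg.prod_shift_sub_ne_zero h a
    have hY := hg.prod_shift_sub_ne_zero y a
    have x1 : shift η ξ h a = ξ a := by simp [shift, ha]
    have x2 : shift η ξ (flipAt h a) a = ξ a - η := by simp [shift, flipAt_self, ha]
    have x3 : shift η ξ y a = ξ a - η := by simp [shift, hya]
    have x4 : shift η ξ (flipAt y a) a = ξ a := by simp [shift, flipAt_self, hya]
    rw [x1] at hX
    rw [x3] at hY
    rw [x1, x2] at v1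
    rw [x3, x4] at v2
    have key : (∏ b ∈ Finset.univ.erase a, (ξ a - η - shift η ξ h b)) *
        (∏ b ∈ Finset.univ.erase a, (ξ a - ξ b + η)) *
        (∏ b ∈ Finset.univ.erase a, (ξ a - η - shift η ξ y b)) =
        (∏ b ∈ Finset.univ.erase a, (ξ a - η - ξ b)) *
        (∏ b ∈ Finset.univ.erase a, (ξ a - shift η ξ y b)) *
        (∏ b ∈ Finset.univ.erase a, (ξ a - shift η ξ h b)) := by
      simp only [← Finset.prod_mul_distrib]
      refine Finset.prod_congr rfl fun b _ => ?_
      rcases fin_two_eq_zero_or_one (h b) with hb | hb <;>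
        simp only [shift, hyd, hb] <;>
        norm_num [-mul_eq_mul_left_iff, -mul_eq_mul_right_iff] <;> ring
    rw [hy, hP, hA, hD]
    generalize ∏ b ∈ Finset.univ.erase a, (ξ a - ξ b + η) = A at *
    generalize ∏ b ∈ Finset.univ.erase a, (ξ a - η - ξ b) = D at *
    generalize ∏ b ∈ Finset.univ.erase a, (ξ a - shift η ξ h b) = U at *
    generalize ∏ b ∈ Finset.univ.erase a, (ξ a - η - shift η ξ h b) = U' at *
    generalize ∏ b ∈ Finset.univ.erase a, (ξ a - η - shift η ξ y b) = W at *
    generalize ∏ b ∈ Finset.univ.erase a, (ξ a - shift η ξ y b) = W' at *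
    generalize (∏ n, if h n = 1 then -(aFun η ξ (ξ n))⁻¹ * dFun ξ (ξ n - η) else 1) = p at *
    have hη := hg.1
    have e : -(η * A)⁻¹ * (-η * D) = D / A := by field_simp
    rw [e, div_mul_eq_mul_div, div_mul_eq_mul_div, div_eq_iff hA0]
    refine mul_right_cancel₀ (mul_ne_zero hX hY) ?_
    linear_combination p * D * U * v2 + D * U * W' * ih - A * W * v1 - vdm (shift η ξ h) * key

lemma prod_ofFn_smul {M : Type*} [Ring M] [Algebra ℂ M] {n : ℕ} (r : Fin n → ℂ) (f : Fin n → M) :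
    (List.ofFn fun i => r i • f i).prod = (∏ i, r i) • (List.ofFn f).prod := by
  induction n with
  | zero => simp
  | succ n ih =>
    rw [List.ofFn_succ, List.prod_cons, ih, Fin.prod_univ_succ, List.ofFn_succ, List.prod_cons,
      smul_mul_smul_comm]

lemma sovKet_eq_bra (hg : Generic η ξ) (h : Fin N → Fin 2) :
    sovKet η ξ h = ((vdm ξ)⁻¹ *
      ∏ n, if h n = 1 then -(aFun η ξ (ξ n))⁻¹ * dFun ξ (ξ n - η) else 1) •
        bra η ξ (chain η ξ (List.finRange N)) (vacuum N) h := by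
  have hT := chain_isSoVRep (ξ := ξ) hg.1 (List.nodup_finRange N) (fun n => List.mem_finRange n)
  rw [sovKet, ← Matrix.vecMul_transpose, Matrix.transpose_list_prod, mul_smul]
  congr 1
  have e1 : (List.map Matrix.transpose (List.ofFn fun n : Fin N =>
      if h n = 1 then (-(aFun η ξ (ξ n))⁻¹) • opB η ξ (ξ n) else 1)) =
      List.ofFn fun n : Fin N => (if h n = 1 then -(aFun η ξ (ξ n))⁻¹ * dFun ξ (ξ n - η) else 1) •
        (if h n = 1 then (dFun ξ (ξ n - η))⁻¹ • chain η ξ (List.finRange N) (ξ n) 1 0 else 1) := by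
    rw [List.map_ofFn]
    congr 1
    funext n
    simp only [Function.comp_apply]
    split_ifs
    · rw [smul_smul, mul_assoc, mul_inv_cancel₀ (hg.dFun_ne_zero n), mul_one,
        Matrix.transpose_smul, opB, monodromyEntry_eq_chain, chain_transpose, List.reverse_reverse]
    · simp
  have e2 : (List.ofFn fun n : Fin N =>
        (if h n = 1 then -(aFun η ξ (ξ n))⁻¹ * dFun ξ (ξ n - η) else 1) •
        (if h n = 1 then (dFun ξ (ξ n - η))⁻¹ • chain η ξ (List.finRange N) (ξ n) 1 0
          else 1)).reverse.prod = _ :=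
    List.Perm.prod_eq' (List.reverse_perm _) (by
      rw [List.pairwise_reverse, List.pairwise_ofFn]
      intro i j _
      refine Commute.smul_right (Commute.smul_left ?_ _) _
      split_ifs
      · exact ((hT.rtt.commute_C hg.1 _ _).smul_left _).smul_right _
      all_goals simp)
  rw [e1, e2, prod_ofFn_smul, Matrix.vecMul_smul]
  rfl

lemma sepKet_eq_sep (hg : Generic η ξ) (Q : ℂ[X]) :
    sepKet η ξ Q = (vdm ξ)⁻¹ • sep η ξ (chain η ξ (List.finRange N)) (vacuum N) Q := by
  rw [sepKet, sep, Finset.smul_sum]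
  refine Finset.sum_congr rfl fun h _ => ?_
  rw [sovKet_eq_bra hg, smul_smul, smul_smul, ← vdm_shift_compl hg h]
  congr 1
  ring

/-- Separate vectors of solutions of the functional equation are eigenvectors. -/
lemma twist_mulVec_sepKet (hg : Generic η ξ) {Q : ℂ[X]} {τ : ℂ → ℂ} (hτ : IsPolyLT N τ)
    (hTQ : ∀ z, τ z * Q.eval z = -(aFun η ξ z * Q.eval (z - η)) + dFun ξ z * Q.eval (z + η))
    (z : ℂ) : twist (chain η ξ (List.finRange N).reverse) z *ᵥ sepKet η ξ Q =
      τ z • sepKet η ξ Q := by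
  have hT := chain_isSoVRep (ξ := ξ) hg.1 (List.nodup_finRange N) (fun n => List.mem_finRange n)
  have ht : (twist (chain η ξ (List.finRange N).reverse) z)ᵀ =
      twist (chain η ξ (List.finRange N)) z := by
    rw [twist, twist, Matrix.transpose_add, chain_transpose, chain_transpose, List.reverse_reverse,
      add_comm]
  rw [← Matrix.vecMul_transpose, ht, sepKet_eq_sep hg, Matrix.smul_vecMul,
    sep_mul_twist hg hT hτ hTQ, smul_comm]

/-! ### Reconstruction of local operators -/

lemma flip_chain_comm_elemAt {l l' : List (Fin N)} {k : Fin N} (hk : k ∉ l) (hk' : k ∉ l') (z : ℂ)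
    (i j i' j' : Fin 2) :
    (flip (chain η ξ l) z * chain η ξ l' z) i j * elemAt k i' j' =
      elemAt k i' j' * (flip (chain η ξ l) z * chain η ξ l' z) i j := by
  simp only [Matrix.mul_apply, Finset.sum_mul, Finset.mul_sum]
  refine Finset.sum_congr rfl fun p _ => ?_
  rw [mul_assoc, chain_comm_elemAt hk', ← mul_assoc, flip, Matrix.of_apply, chain_comm_elemAt hk,
    mul_assoc]

lemma isRTT_flip_chain_mul {l l' : List (Fin N)} (hl : l.Nodup) (hl' : l'.Nodup)
    (h : ∀ n ∈ l, n ∉ l') : IsRTT η (fun z => flip (chain η ξ l) z * chain η ξ l' z) :=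
  (chain_isRTT hl).flip.mul (chain_isRTT hl') (chain_comm_chain h).flip_left

lemma prod_twist_mul_chain {r : List (Fin N)} (hr : r.Nodup) (p rest : List (Fin N))
    (hp : p ++ rest = r) (z : ℂ) (a b : Fin 2) :
    (p.map fun n => twist (chain η ξ r.reverse) (ξ n)).prod * chain η ξ r.reverse z a b =
      (flip (chain η ξ p.reverse) z * chain η ξ rest.reverse z) a b *
        (p.map fun n => twist (chain η ξ r.reverse) (ξ n)).prod := by
  induction p using List.reverseRecOn generalizing rest z a b with
  | nil =>
    subst hp
    have : flip (chain η ξ []) z = 1 := by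
      ext i j : 2
      fin_cases i <;> fin_cases j <;> simp [flip, chain_nil]
    simp [this]
  | append_singleton p n ih =>
    have hp' : p ++ (n :: rest) = r := by simpa using hp
    have hnd : (p ++ (n :: rest)).Nodup := hp' ▸ hr
    have ih' := ih (n :: rest) hp'
    rw [List.nodup_append'] at hnd
    obtain ⟨h1, h2, h3⟩ := hnd
    rw [List.nodup_cons] at h2
    have hnp : n ∉ p := fun h => h3 h (by simp)
    set X := fun z => flip (chain η ξ p.reverse) z * chain η ξ rest.reverse z with hX
    have hZ : (fun z => flip (chain η ξ p.reverse) z * chain η ξ (n :: rest).reverse z) =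
        fun z => X z * siteLax η ξ n z := by
      funext z
      rw [List.reverse_cons, chain_append, chain_singleton, hX, mul_assoc]
    have hZ' : ∀ z, flip (chain η ξ (p ++ [n]).reverse) z * chain η ξ rest.reverse z =
        flip (siteLax η ξ n) z * X z := by
      intro z
      rw [List.reverse_append, List.reverse_singleton, List.singleton_append, chain_cons, flip_mul,
        hX, mul_assoc]
    have hXr : IsRTT η X := isRTT_flip_chain_mul (List.nodup_reverse.2 h1)
      (List.nodup_reverse.2 h2.2) fun k hk hk' => h3 (List.mem_reverse.1 hk)
        (by simp [List.mem_reverse.1 hk'])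
    have hXc : ∀ x i j k l, X x i j * elemAt n k l = elemAt n k l * X x i j := fun x i j k l =>
      flip_chain_comm_elemAt (by simpa using hnp) (by simpa using h2.1) x i j k l
    have ht : (p.map fun n => twist (chain η ξ r.reverse) (ξ n)).prod *
        twist (chain η ξ r.reverse) (ξ n) = twist (fun z => X z * siteLax η ξ n z) (ξ n) *
          (p.map fun n => twist (chain η ξ r.reverse) (ξ n)).prod := by
      rw [← hZ, twist, twist, mul_add, ih', ih', add_mul]
    rw [List.map_append, List.prod_append, List.map_singleton, List.prod_singleton, ht, mul_assoc,
      ih', hZ', ← mul_assoc, ← mul_assoc, congrFun hZ z]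
    congr 1
    exact twist_mul_intertwine (isMatrixUnits_elemAt n) hXr hXc z a b

lemma elemAt_mul_prod_twist {r : List (Fin N)} (hr : r.Nodup) (p rest : List (Fin N)) (n : Fin N)
    (hp : p ++ n :: rest = r) (a b : Fin 2) :
    elemAt n b (1 - a) * ((p.map fun n => twist (chain η ξ r.reverse) (ξ n)).prod *
        twist (chain η ξ r.reverse) (ξ n)) =
      (p.map fun n => twist (chain η ξ r.reverse) (ξ n)).prod *
        chain η ξ r.reverse (ξ n) a b := by
  have hnd : (p ++ (n :: rest)).Nodup := hp ▸ hr
  rw [List.nodup_append'] at hnd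
  obtain ⟨h1, h2, h3⟩ := hnd
  rw [List.nodup_cons] at h2
  have hnp : n ∉ p := fun h => h3 h (by simp)
  set X := fun z => flip (chain η ξ p.reverse) z * chain η ξ rest.reverse z with hX
  have hZ : (fun z => flip (chain η ξ p.reverse) z * chain η ξ (n :: rest).reverse z) =
      fun z => X z * siteLax η ξ n z := by
    funext z
    rw [List.reverse_cons, chain_append, chain_singleton, hX, mul_assoc]
  have hXc : ∀ x i j k l, X x i j * elemAt n k l = elemAt n k l * X x i j := fun x i j k l =>
    flip_chain_comm_elemAt (by simpa using hnp) (by simpa using h2.1) x i j k l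
  have h := prod_twist_mul_chain (η := η) (ξ := ξ) hr p (n :: rest) hp
  have ht : (p.map fun n => twist (chain η ξ r.reverse) (ξ n)).prod *
      twist (chain η ξ r.reverse) (ξ n) = twist (fun z => X z * siteLax η ξ n z) (ξ n) *
        (p.map fun n => twist (chain η ξ r.reverse) (ξ n)).prod := by
    rw [← hZ, twist, twist, mul_add, h, h, add_mul]
  rw [ht, ← mul_assoc, h, congrFun hZ (ξ n)]
  congr 1
  exact unit_mul_twist (isMatrixUnits_elemAt n) hXc a b

lemma prod_elemAt_mul_prod_twist {r : List (Fin N)} (hr : r.Nodup) (e : Fin N → Fin 2 × Fin 2)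
    (p rest : List (Fin N)) (hp : p ++ rest = r) :
    (p.map fun n => elemAt n (e n).1 (e n).2).prod *
        (p.map fun n => twist (chain η ξ r.reverse) (ξ n)).prod =
      (p.map fun n => chain η ξ r.reverse (ξ n) (1 - (e n).2) (e n).1).prod := by
  induction p using List.reverseRecOn generalizing rest with
  | nil => simp
  | append_singleton p n ih =>
    have hp' : p ++ (n :: rest) = r := by simpa using hp
    have h := elemAt_mul_prod_twist (η := η) (ξ := ξ) hr p rest n hp' (1 - (e n).2) (e n).1
    rw [sub_sub_cancel] at h
    simp only [List.map_append, List.prod_append, List.map_singleton, List.prod_singleton]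
    rw [mul_assoc, h, ← mul_assoc, ih _ hp']

lemma prod_twist_mulVec_sepKet (hg : Generic η ξ) {Q : ℂ[X]} {τ : ℂ → ℂ} (hτ : IsPolyLT N τ)
    (hTQ : ∀ z, τ z * Q.eval z = -(aFun η ξ z * Q.eval (z - η)) + dFun ξ z * Q.eval (z + η))
    (p : List (Fin N)) :
    (p.map fun n => twist (chain η ξ (List.finRange N).reverse) (ξ n)).prod *ᵥ sepKet η ξ Q =
      (p.map fun n => τ (ξ n)).prod • sepKet η ξ Q := by
  induction p with
  | nil => simp
  | cons n p ih =>
    rw [List.map_cons, List.prod_cons, ← Matrix.mulVec_mulVec, ih, Matrix.mulVec_smul,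
      twist_mulVec_sepKet hg hτ hTQ, smul_smul, List.map_cons, List.prod_cons, mul_comm]

lemma finRange_eq_map_castLE_append {m : ℕ} (hm : m ≤ N) :
    (List.finRange m).map (Fin.castLE hm) ++ (List.finRange N).drop m = List.finRange N := by
  have : (List.finRange m).map (Fin.castLE hm) = (List.finRange N).take m := by
    apply List.ext_getElem
    · simp [hm]
    · intro i h1 h2
      simp
  rw [this, List.take_append_drop]

/-- Elementary blocks as matrix elements of products of entries of the monodromy matrix. -/
lemma sepBra_elemAt_sepKet (hg : Generic η ξ) {Q : ℂ[X]} {τ : ℂ → ℂ} (hτ : IsPolyLT N τ)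
    (hTQ : ∀ z, τ z * Q.eval z = -(aFun η ξ z * Q.eval (z - η)) + dFun ξ z * Q.eval (z + η))
    {m : ℕ} (hm : m ≤ N) (ε : Fin m → Fin 2 × Fin 2) :
    (∏ k : Fin m, τ (ξ (Fin.castLE hm k))) * (sepBra η ξ Q ⬝ᵥ
      ((List.ofFn fun j : Fin m => elemAt (Fin.castLE hm j) (ε j).1 (ε j).2).prod *ᵥ
        sepKet η ξ Q)) =
      (sepBra η ξ Q ᵥ* (List.ofFn fun j : Fin m => chain η ξ (List.finRange N).reverse
        (ξ (Fin.castLE hm j)) (1 - (ε j).2) (ε j).1).prod) ⬝ᵥ sepKet η ξ Q := by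
  let e : Fin N → Fin 2 × Fin 2 := fun n => if h : n.val < m then ε ⟨n.val, h⟩ else 0
  have he : ∀ j : Fin m, e (Fin.castLE hm j) = ε j := fun j => by simp [e]
  have h := prod_elemAt_mul_prod_twist (η := η) (ξ := ξ) (List.nodup_finRange N) e _ _
    (finRange_eq_map_castLE_append hm)
  have h' := congrArg (fun M => sepBra η ξ Q ⬝ᵥ (M *ᵥ sepKet η ξ Q)) h
  simp only [← Matrix.mulVec_mulVec] at h'
  rw [prod_twist_mulVec_sepKet hg hτ hTQ] at h'
  simp only [List.map_map, Function.comp_def, he, Matrix.mulVec_smul, dotProduct_smul,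
    smul_eq_mul] at h'
  rw [← Matrix.dotProduct_mulVec]
  simp only [← List.ofFn_eq_map] at h'
  rw [← h', List.prod_ofFn]

end

/-! ### Transfer matrix eigenvalues -/

section

variable {N : ℕ} {η : ℂ} {ξ : Fin N → ℂ}

lemma isPolyLT_of_functional_equation {R : ℕ} {lam : Fin R → ℂ} (hlam : Function.Injective lam)
    {τ : ℂ → ℂ} (hτ : Continuous τ)
    (hTQ : ∀ z, τ z * (rootPoly Finset.univ lam).eval z =
      -(aFun η ξ z * (rootPoly Finset.univ lam).eval (z - η)) +
        dFun ξ z * (rootPoly Finset.univ lam).eval (z + η)) : IsPolyLT N τ := by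
  set Q := rootPoly Finset.univ lam with hQ
  set F := rootPoly Finset.univ ξ * Q.comp (X + C η) with hF
  set G := rootPoly Finset.univ (fun n => ξ n - η) * Q.comp (X + C (-η)) with hG
  have hFG : ∀ z, (F - G).eval z = τ z * Q.eval z := fun z => by
    rw [hTQ, hF, hG]
    simp only [eval_sub, eval_mul, eval_comp, eval_rootPoly, aFun, dFun, eval_add, eval_X, eval_C,
      ← sub_eq_add_neg, sub_add]
    ring
  have hdvd : Q ∣ F - G := by
    refine Finset.prod_dvd_of_coprime
      ((pairwise_coprime_X_sub_C hlam).set_pairwise _) fun i _ => ?_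
    rw [dvd_iff_isRoot, IsRoot.def, hFG, eval_rootPoly,
      Finset.prod_eq_zero (Finset.mem_univ i) (sub_self _), mul_zero]
  obtain ⟨W, hW⟩ := hdvd
  have hQm : Q.Monic := rootPoly_monic _ _
  refine ⟨W, ?_, fun z => ?_⟩
  · by_cases hW0 : W = 0
    · simp [hW0]
    have hFm : F.Monic := rootPoly_mul_comp_monic _ _ _ _
    have hGm : G.Monic := rootPoly_mul_comp_monic _ _ _ _
    have hFd : F.degree = ((N + R : ℕ) : WithBot ℕ) := by
      rw [degree_eq_natDegree hFm.ne_zero, hF, hQ, natDegree_rootPoly_mul_comp]; simp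
    have hGd : G.degree = ((N + R : ℕ) : WithBot ℕ) := by
      rw [degree_eq_natDegree hGm.ne_zero, hG, hQ, natDegree_rootPoly_mul_comp]; simp
    have hlt := degree_sub_lt_left (hFd.trans hGd.symm) hFm.ne_zero
      (by rw [hFm.leadingCoeff, hGm.leadingCoeff])
    rw [hW, hFd, degree_mul, degree_eq_natDegree hQm.ne_zero, hQ, natDegree_rootPoly,
      degree_eq_natDegree hW0] at hlt
    rw [degree_eq_natDegree hW0]
    have h1 : R + W.natDegree < N + R := by
      rw [Finset.card_univ, Fintype.card_fin] at hlt
      exact_mod_cast hlt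
    have h2 : W.natDegree < N := by omega
    exact_mod_cast h2
  · refine congrFun (hτ.ext_on ((Set.finite_range lam).countable.dense_compl ℂ) W.continuous
      fun z hz => ?_) z
    have hQz : Q.eval z ≠ 0 := by
      rw [hQ, eval_rootPoly]
      exact Finset.prod_ne_zero_iff.2 fun i _ => sub_ne_zero.2 fun h => hz ⟨i, h.symm⟩
    refine mul_right_cancel₀ hQz ?_
    rw [← hFG, hW, eval_mul, mul_comm]

lemma eigenvalue_ne_zero (hg : Generic η ξ) {Q : ℂ[X]} {τ : ℂ → ℂ}
    (hTQ : ∀ z, τ z * Q.eval z = -(aFun η ξ z * Q.eval (z - η)) + dFun ξ z * Q.eval (z + η))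
    {n : Fin N} (hQ : Q.eval (ξ n) ≠ 0) : τ (ξ n) ≠ 0 := by
  intro h0
  have h1 := hTQ (ξ n)
  rw [h0, dFun_self] at h1
  have h2 : Q.eval (ξ n - η) = 0 := by
    have : aFun η ξ (ξ n) * Q.eval (ξ n - η) = 0 := by linear_combination h1
    exact (mul_eq_zero.1 this).resolve_left (hg.aFun_ne_zero n)
  have h3 := hTQ (ξ n - η)
  rw [h2, aFun_self_sub, sub_add_cancel] at h3
  have : dFun ξ (ξ n - η) * Q.eval (ξ n) = 0 := by linear_combination -h3
  exact (mul_ne_zero (hg.dFun_ne_zero n) hQ) this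

end

/-! ### Sums over histories -/

section

variable {κ : Type*} [Fintype κ] [DecidableEq κ]

/-- `A` without the chosen element, if any. -/
def eraseOpt (A : Finset κ) (o : Option κ) : Finset κ := A.filter fun b => some b ≠ o

/-- The indices that were not chosen before time `t`. -/
def remaining {m : ℕ} (c : Fin m → Option κ × Option κ) (t : ℕ) : Finset κ :=
  Finset.univ.filter fun b => ∀ k : Fin m, k.val < t → some b ≠ (c k).1 ∧ some b ≠ (c k).2

lemma remaining_zero {m : ℕ} (c : Fin m → Option κ × Option κ) :
    remaining c 0 = Finset.univ := by
  simp [remaining]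

lemma remaining_snoc {m : ℕ} (c : Fin m → Option κ × Option κ) (o : Option κ × Option κ) {t : ℕ}
    (ht : t ≤ m) : remaining (Fin.snoc c o : Fin (m + 1) → Option κ × Option κ) t =
      remaining c t := by
  ext b
  simp only [remaining, Finset.mem_filter, Finset.mem_univ, true_and]
  constructor
  · intro h k hk
    simpa using h k.castSucc (by simpa using hk)
  · intro h k hk
    have hkm : k.val < m := by omega
    have : k = Fin.castSucc ⟨k.val, hkm⟩ := rfl
    rw [this, Fin.snoc_castSucc]
    exact h ⟨k.val, hkm⟩ hk

lemma remaining_snoc_last {m : ℕ} (c : Fin m → Option κ × Option κ) (o : Option κ × Option κ) :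
    remaining (Fin.snoc c o : Fin (m + 1) → Option κ × Option κ) (m + 1) =
      eraseOpt (eraseOpt (remaining c m) o.1) o.2 := by
  ext b
  simp only [remaining, eraseOpt, Finset.mem_filter, Finset.mem_univ, true_and, Fin.is_lt,
    true_implies]
  constructor
  · intro h
    have hl := h (Fin.last m)
    rw [Fin.snoc_last] at hl
    exact ⟨⟨fun k => by simpa using h k.castSucc, hl.1⟩, hl.2⟩
  · rintro ⟨⟨h1, h2⟩, h3⟩ k
    refine Fin.lastCases ?_ (fun k => ?_) k
    · rw [Fin.snoc_last]; exact ⟨h2, h3⟩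
    · rw [Fin.snoc_castSucc]; exact h1 k

lemma vecMul_prod_eq_sum_histories {S : Type*} [Fintype S] [DecidableEq S] {m : ℕ}
    (T : Fin m → Matrix S S ℂ) (vec : ℕ → Finset κ → S → ℂ) (valid : ℕ → Finset κ → Prop)
    (w : Fin m → Finset κ → Option κ × Option κ → ℂ) (h0 : valid 0 Finset.univ)
    (hstep : ∀ (j : Fin m) A, valid j A → vec j A ᵥ* T j =
      ∑ o, w j A o • vec (j + 1) (eraseOpt (eraseOpt A o.1) o.2))
    (hvalid : ∀ (j : Fin m) A o, valid j A → w j A o ≠ 0 →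
      valid (j + 1) (eraseOpt (eraseOpt A o.1) o.2)) :
    vec 0 Finset.univ ᵥ* (List.ofFn T).prod =
        ∑ c : Fin m → Option κ × Option κ,
          (∏ j : Fin m, w j (remaining c j) (c j)) • vec m (remaining c m) ∧
      ∀ c : Fin m → Option κ × Option κ, ∏ j : Fin m, w j (remaining c j) (c j) ≠ 0 →
        valid m (remaining c m) := by
  induction m with
  | zero => simp [remaining_zero, h0]
  | succ m ih =>
    obtain ⟨ih1, ih2⟩ := ih (fun j => T j.castSucc) (fun j => w j.castSucc)
      (fun j A hA => hstep j.castSucc A hA) (fun j A o hA ho => hvalid j.castSucc A o hA ho)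
    have hw : ∀ (c : Fin m → Option κ × Option κ) (o : Option κ × Option κ),
        ∏ j : Fin (m + 1), w j (remaining (Fin.snoc c o : Fin (m + 1) → _) j)
          ((Fin.snoc c o : Fin (m + 1) → _) j) =
        (∏ j : Fin m, w j.castSucc (remaining c j) (c j)) *
          w (Fin.last m) (remaining c m) o := by
      intro c o
      rw [Fin.prod_univ_castSucc]
      congr 1
      · refine Finset.prod_congr rfl fun j _ => ?_
        rw [Fin.snoc_castSucc, remaining_snoc _ _ (by simp)]
        rfl
      · rw [Fin.snoc_last, remaining_snoc _ _ (by simp)]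
        rfl
    constructor
    · rw [List.ofFn_succ', List.concat_eq_append, List.prod_append, List.prod_singleton,
        ← Matrix.vecMul_vecMul, ih1, Matrix.sum_vecMul,
        ← (Fin.snocEquiv fun _ : Fin (m + 1) => Option κ × Option κ).sum_comp,
        Fintype.sum_prod_type_right]
      refine Finset.sum_congr rfl fun c _ => ?_
      rw [Matrix.smul_vecMul]
      by_cases hc : ∏ j : Fin m, w j.castSucc (remaining c j) (c j) = 0
      · rw [hc, zero_smul, Finset.sum_eq_zero]
        intro o _
        have := hw c o
        rw [hc, zero_mul] at this
        simp only [Fin.snocEquiv, Equiv.coe_fn_mk]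
        rw [this, zero_smul]
      · have := hstep (Fin.last m) _ (ih2 c hc)
        rw [Fin.val_last] at this
        rw [this, Finset.smul_sum]
        refine Finset.sum_congr rfl fun o _ => ?_
        simp only [Fin.snocEquiv, Equiv.coe_fn_mk]
        rw [hw, remaining_snoc_last, smul_smul]
    · intro c hc
      obtain ⟨c, o, rfl⟩ : ∃ c' o, c = Fin.snoc c' o := ⟨_, _, (Fin.snoc_init_self c).symm⟩
      rw [hw] at hc
      rw [remaining_snoc_last]
      exact hvalid (Fin.last m) _ o (ih2 c (left_ne_zero_of_mul hc)) (right_ne_zero_of_mul hc)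

end

section

variable {ι κ : Type*} [DecidableEq ι]

/-- The partial function with domain `s` given by `a`. -/
def extendOpt (s : Finset ι) (a : s → κ) (i : ι) : Option κ :=
  if h : i ∈ s then some (a ⟨i, h⟩) else none

lemma extendOpt_of_mem {s : Finset ι} (a : s → κ) (i : s) : extendOpt s a i = some (a i) := by
  simp [extendOpt]

lemma extendOpt_of_notMem {s : Finset ι} (a : s → κ) {i : ι} (h : i ∉ s) :
    extendOpt s a i = none := by
  simp [extendOpt, h]

lemma sum_option_fun [Fintype ι] [Fintype κ] {M : Type*} [AddCommMonoid M]
    (G : (ι → Option κ) → M) :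
    ∑ f, G f = ∑ s : Finset ι, ∑ a : s → κ, G (extendOpt s a) := by
  rw [← Fintype.sum_sigma' (fun (s : Finset ι) (a : s → κ) => G (extendOpt s a))]
  symm
  refine Fintype.sum_bijective (fun x : (Σ s : Finset ι, s → κ) => extendOpt x.1 x.2)
    ⟨?_, ?_⟩ _ _ fun x => rfl
  · rintro ⟨s, a⟩ ⟨s', a'⟩ h
    have hs : s = s' := by
      ext i
      have hi := congrArg Option.isSome (congrFun h i)
      by_cases h1 : i ∈ s <;> by_cases h2 : i ∈ s' <;> simp_all [extendOpt]
    subst hs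
    have ha : a = a' := funext fun i => by
      have hi := congrFun h i
      simpa [extendOpt_of_mem] using hi
    rw [ha]
  · intro f
    classical
    refine ⟨⟨Finset.univ.filter fun i => (f i).isSome,
      fun i => (f i).get (Finset.mem_filter.1 i.2).2⟩, funext fun i => ?_⟩
    by_cases h : (f i).isSome
    · simp [extendOpt, h]
    · exact (extendOpt_of_notMem _ (by simp [Option.not_isSome_iff_eq_none.1 h])).trans
        (Option.not_isSome_iff_eq_none.1 h).symm

end

/-! ### One step of the multiple action -/

section

variable {N R m : ℕ}

/-- The coefficients of the action of the row index `e`; `none` leaves all roots in place. -/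
def coeffMinus (η : ℂ) (ξ : Fin N → ℂ) (q : Fin (R + m) → ℂ) (e : Fin 2) (j : ℕ)
    (A : Finset (Fin (R + m))) : Option (Fin (R + m)) → ℂ
  | none => if e = 0 then -1 else 1
  | some a =>
    if e = 0 ∧ a.val < R + (j + 1) ∧ a ∈ A then
      (-1) ^ N * (dFun ξ (q a) * (∏ k ∈ A.filter (fun k => k.val < R + j), (q a - q k + η)) /
        ∏ k ∈ (eraseOpt A (some a)).filter (fun k => k.val < R + (j + 1)), (q a - q k))
    else 0

/-- The coefficients of the action of the column index `e`; `none` leaves all roots in place. -/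
def coeffPlus (η : ℂ) (ξ : Fin N → ℂ) (q : Fin (R + m) → ℂ) (e : Fin 2) (j : ℕ)
    (A : Finset (Fin (R + m))) : Option (Fin (R + m)) → ℂ
  | none => 1
  | some a =>
    if e = 1 ∧ a.val < R + (j + 1) ∧ a ∈ A then
      (-1) ^ N * -(aFun η ξ (q a) * (∏ k ∈ A.filter (fun k => k.val < R + j), (q k - q a + η)) /
        ∏ k ∈ (eraseOpt A (some a)).filter (fun k => k.val < R + (j + 1)), (q k - q a))
    else 0

/-- No index from `R + j` on was removed. -/
def Untouched (R : ℕ) {m : ℕ} (j : ℕ) (A : Finset (Fin (R + m))) : Prop :=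
  ∀ k : Fin (R + m), R + j ≤ k.val → k ∈ A

/-- The separate covector whose roots are the available indices of `A`. -/
def sepOf (η : ℂ) (ξ : Fin N → ℂ)
    (T : ℂ → Matrix (Fin 2) (Fin 2) (Matrix (Fin N → Fin 2) (Fin N → Fin 2) ℂ))
    (q : Fin (R + m) → ℂ) (j : ℕ) (A : Finset (Fin (R + m))) : (Fin N → Fin 2) → ℂ :=
  sep η ξ T (vacuum N) (rootPoly (A.filter fun k => k.val < R + j) q)

lemma filter_lt_succ {j : Fin m} {A : Finset (Fin (R + m))} (hA : Untouched R j A) :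
    (A.filter fun k => k.val < R + (j.val + 1)) =
      insert (Fin.natAdd R j) (A.filter fun k => k.val < R + j.val) := by
  ext k
  simp only [Finset.mem_filter, Finset.mem_insert, Fin.ext_iff, Fin.val_natAdd]
  constructor
  · rintro ⟨h1, h2⟩
    by_cases h : k.val = R + j
    · exact Or.inl h
    · exact Or.inr ⟨h1, by omega⟩
  · rintro (h | ⟨h1, h2⟩)
    · exact ⟨hA k h.ge, by omega⟩
    · exact ⟨h1, by omega⟩

lemma natAdd_notMem_filter_lt (j : Fin m) (A : Finset (Fin (R + m))) :
    Fin.natAdd R j ∉ A.filter fun k => k.val < R + j.val := by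
  simp

lemma filter_eraseOpt (A : Finset (Fin (R + m))) (a : Fin (R + m)) (p : Fin (R + m) → Prop)
    [DecidablePred p] : (eraseOpt A (some a)).filter p = (A.filter p).erase a := by
  ext k
  simp only [eraseOpt, Finset.mem_filter, Finset.mem_erase, ne_eq, Option.some.injEq]
  tauto

lemma eraseOpt_none (A : Finset (Fin (R + m))) : eraseOpt A none = A := by
  simp [eraseOpt]

lemma Untouched.eraseOpt {j : ℕ} {A : Finset (Fin (R + m))} (hA : Untouched R j A)
    {o : Option (Fin (R + m))} (ho : ∀ a, o = some a → a.val < R + j) :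
    Untouched R j (eraseOpt A o) := by
  intro k hk
  refine Finset.mem_filter.2 ⟨hA k hk, fun h => ?_⟩
  have := ho k h.symm
  omega

lemma Untouched.mono {j : ℕ} {A : Finset (Fin (R + m))} (hA : Untouched R j A) :
    Untouched R (j + 1) A := fun k hk => hA k (by omega)

variable {η : ℂ} {ξ : Fin N → ℂ} {q : Fin (R + m) → ℂ} {hm : m ≤ N}
  {T : ℂ → Matrix (Fin 2) (Fin 2) (Matrix (Fin N → Fin 2) (Fin N → Fin 2) ℂ)}

lemma untouched_of_coeffMinus_ne_zero (hqξ : ∀ j : Fin m, q (Fin.natAdd R j) = ξ (Fin.castLE hm j))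
    {e : Fin 2} {j : Fin m} {A : Finset (Fin (R + m))} (hA : Untouched R j A)
    {o : Option (Fin (R + m))} (ho : coeffMinus η ξ q e j A o ≠ 0) :
    Untouched R j (eraseOpt A o) := by
  refine hA.eraseOpt fun a ha => ?_
  subst ha
  simp only [coeffMinus] at ho
  split_ifs at ho with h
  · by_contra hlt
    have : a = Fin.natAdd R j := Fin.ext (by simp only [Fin.val_natAdd]; omega)
    rw [this, hqξ, dFun_self] at ho
    simp at ho
  · exact absurd rfl ho

lemma untouched_of_coeffPlus_ne_zero {e : Fin 2} {j : Fin m} {A : Finset (Fin (R + m))}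
    (hA : Untouched R j A) {o : Option (Fin (R + m))} (ho : coeffPlus η ξ q e j A o ≠ 0) :
    Untouched R (j + 1) (eraseOpt A o) := by
  refine hA.mono.eraseOpt fun a ha => ?_
  subst ha
  simp only [coeffPlus] at ho
  split_ifs at ho with h
  · exact h.2.1
  · exact absurd rfl ho

lemma neg_one_pow_mul_self (n : ℕ) : (-1 : ℂ) ^ n * (-1) ^ n = 1 := by
  rw [← mul_pow]; simp

lemma sepOf_mul_D (hg : Generic η ξ) (hT : IsSoVRep η ξ T (vacuum N))
    (hqξ : ∀ j : Fin m, q (Fin.natAdd R j) = ξ (Fin.castLE hm j))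
    {j : Fin m} {A : Finset (Fin (R + m))} (hA : Untouched R j A) :
    sepOf η ξ T q j A ᵥ* T (ξ (Fin.castLE hm j)) 1 1 =
      (-1 : ℂ) ^ N • sepOf η ξ T q (j + 1) A := by
  rw [← hqξ, sepOf, sep_mul_D hg hT q (natAdd_notMem_filter_lt j A), sepOf, filter_lt_succ hA]

lemma sepOf_mul_minus (hg : Generic η ξ) (hT : IsSoVRep η ξ T (vacuum N))
    (hq : Function.Injective q)
    (hqξ : ∀ j : Fin m, q (Fin.natAdd R j) = ξ (Fin.castLE hm j)) (e f : Fin 2)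
    {j : Fin m} {A : Finset (Fin (R + m))} (hA : Untouched R j A) :
    sepOf η ξ T q j A ᵥ* T (ξ (Fin.castLE hm j)) f e =
      (∑ o, coeffMinus η ξ q e j A o • sepOf η ξ T q j (eraseOpt A o)) ᵥ*
        T (ξ (Fin.castLE hm j)) f 1 := by
  rcases fin_two_eq_zero_or_one e with rfl | rfl
  · have hD : (∑ o, coeffMinus η ξ q 0 j A o • sepOf η ξ T q j (eraseOpt A o)) ᵥ*
        T (ξ (Fin.castLE hm j)) 1 1 =
        sepOf η ξ T q j A ᵥ* T (ξ (Fin.castLE hm j)) 1 0 := by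
      have h1 : ∀ o, (coeffMinus η ξ q 0 j A o • sepOf η ξ T q j (eraseOpt A o)) ᵥ*
          T (ξ (Fin.castLE hm j)) 1 1 =
          (coeffMinus η ξ q 0 j A o * (-1) ^ N) • sepOf η ξ T q (j + 1) (eraseOpt A o) := by
        intro o
        by_cases ho : coeffMinus η ξ q 0 j A o = 0
        · simp [ho]
        · rw [Matrix.smul_vecMul,
            sepOf_mul_D hg hT hqξ (untouched_of_coeffMinus_ne_zero hqξ hA ho), smul_smul]
      rw [Matrix.sum_vecMul, Finset.sum_congr rfl fun o _ => h1 o, Fintype.sum_option]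
      conv_rhs => rw [← hqξ, sepOf, sep_mul_C hg hT (natAdd_notMem_filter_lt j A) hq.injOn,
        ← filter_lt_succ hA]
      congr 1
      · simp only [coeffMinus, if_true, eraseOpt_none, sepOf]
        module
      · rw [← Finset.sum_subset (Finset.subset_univ (A.filter fun k => k.val < R + (j.val + 1)))]
        · refine Finset.sum_congr rfl fun a ha => ?_
          rw [Finset.mem_filter] at ha
          simp only [coeffMinus]
          rw [if_pos ⟨trivial, ha.2, ha.1⟩, sepOf, filter_eraseOpt]
          congr 1
          linear_combination (dFun ξ (q a) *
            (∏ k ∈ A.filter (fun k => k.val < R + j), (q a - q k + η)) /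
            ∏ k ∈ (A.filter (fun k => k.val < R + (j + 1))).erase a, (q a - q k)) *
              neg_one_pow_mul_self N
        · intro a _ ha
          rw [Finset.mem_filter] at ha
          simp only [coeffMinus]
          rw [if_neg (by tauto), zero_mul, zero_smul]
    rcases fin_two_eq_zero_or_one f with rfl | rfl
    · exact (vecMul_B_eq_vecMul_A hg hT hD).symm
    · exact hD.symm
  · rw [Fintype.sum_option]
    simp [coeffMinus, eraseOpt_none]

lemma sepOf_mul_plus (hg : Generic η ξ) (hT : IsSoVRep η ξ T (vacuum N))
    (hq : Function.Injective q)
    (hqξ : ∀ j : Fin m, q (Fin.natAdd R j) = ξ (Fin.castLE hm j)) (e : Fin 2)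
    {j : Fin m} {A : Finset (Fin (R + m))} (hA : Untouched R j A) :
    sepOf η ξ T q j A ᵥ* T (ξ (Fin.castLE hm j)) (1 - e) 1 =
      ∑ o, ((-1) ^ N * coeffPlus η ξ q e j A o) • sepOf η ξ T q (j + 1) (eraseOpt A o) := by
  rw [Fintype.sum_option]
  rcases fin_two_eq_zero_or_one e with rfl | rfl
  · rw [sub_zero, sepOf_mul_D hg hT hqξ hA]
    simp [coeffPlus, eraseOpt_none]
  · rw [sub_self, ← hqξ, sepOf, sep_mul_B hg hT (natAdd_notMem_filter_lt j A) hq.injOn,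
      ← filter_lt_succ hA]
    congr 1
    · simp [coeffPlus, eraseOpt_none, sepOf]
    · rw [← Finset.sum_subset (Finset.subset_univ (A.filter fun k => k.val < R + (j.val + 1)))]
      · refine Finset.sum_congr rfl fun a ha => ?_
        rw [Finset.mem_filter] at ha
        simp only [coeffPlus]
        rw [if_pos ⟨trivial, ha.2, ha.1⟩, sepOf, filter_eraseOpt, ← mul_assoc,
          neg_one_pow_mul_self, one_mul]
      · intro a _ ha
        rw [Finset.mem_filter] at ha
        simp only [coeffPlus]
        rw [if_neg (by tauto), mul_zero, zero_smul]

/-- The coefficient of one step. -/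
def coeffStep (η : ℂ) (ξ : Fin N → ℂ) (q : Fin (R + m) → ℂ) (e : Fin 2 × Fin 2) (j : ℕ)
    (A : Finset (Fin (R + m))) (o : Option (Fin (R + m)) × Option (Fin (R + m))) : ℂ :=
  (-1) ^ N * coeffMinus η ξ q e.1 j A o.1 * coeffPlus η ξ q e.2 j (eraseOpt A o.1) o.2

lemma sepOf_mul_step (hg : Generic η ξ) (hT : IsSoVRep η ξ T (vacuum N))
    (hq : Function.Injective q)
    (hqξ : ∀ j : Fin m, q (Fin.natAdd R j) = ξ (Fin.castLE hm j)) (e : Fin 2 × Fin 2)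
    {j : Fin m} {A : Finset (Fin (R + m))} (hA : Untouched R j A) :
    sepOf η ξ T q j A ᵥ* T (ξ (Fin.castLE hm j)) (1 - e.2) e.1 =
      ∑ o, coeffStep η ξ q e j A o •
        sepOf η ξ T q (j + 1) (eraseOpt (eraseOpt A o.1) o.2) := by
  rw [sepOf_mul_minus hg hT hq hqξ _ _ hA, Matrix.sum_vecMul, Fintype.sum_prod_type]
  refine Finset.sum_congr rfl fun o₁ _ => ?_
  rw [Matrix.smul_vecMul]
  by_cases ho : coeffMinus η ξ q e.1 j A o₁ = 0
  · simp [coeffStep, ho]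
  · rw [sepOf_mul_plus hg hT hq hqξ e.2 (untouched_of_coeffMinus_ne_zero hqξ hA ho),
      Finset.smul_sum]
    refine Finset.sum_congr rfl fun o₂ _ => ?_
    rw [smul_smul, coeffStep]
    congr 1
    ring

/-- The action of a product of entries of the monodromy matrix as a sum over histories. -/
lemma sepOf_mul_prod (hg : Generic η ξ) (hT : IsSoVRep η ξ T (vacuum N))
    (hq : Function.Injective q)
    (hqξ : ∀ j : Fin m, q (Fin.natAdd R j) = ξ (Fin.castLE hm j)) (ε : Fin m → Fin 2 × Fin 2) :
    sepOf η ξ T q 0 Finset.univ ᵥ* (List.ofFn fun j : Fin m =>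
        T (ξ (Fin.castLE hm j)) (1 - (ε j).2) (ε j).1).prod =
      ∑ c : Fin m → Option (Fin (R + m)) × Option (Fin (R + m)),
        (∏ j : Fin m, coeffStep η ξ q (ε j) j (remaining c j) (c j)) •
          sepOf η ξ T q m (remaining c m) := by
  refine (vecMul_prod_eq_sum_histories _ (sepOf η ξ T q) (Untouched R)
    (fun j => coeffStep η ξ q (ε j) j) (fun k _ => Finset.mem_univ k)
    (fun j A hA => sepOf_mul_step hg hT hq hqξ (ε j) hA) fun j A o hA ho => ?_).1
  exact untouched_of_coeffPlus_ne_zero (untouched_of_coeffMinus_ne_zero hqξ hA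
    (right_ne_zero_of_mul (left_ne_zero_of_mul ho))) (right_ne_zero_of_mul ho)

end

/-! ### The multiple sum -/

section

variable {R m : ℕ} {bm bp : Finset (Fin m)}

/-- The history with choices `a` and `a'`. -/
def history (a : bm → Fin (R + m)) (a' : bp → Fin (R + m)) (j : Fin m) :
    Option (Fin (R + m)) × Option (Fin (R + m)) :=
  (extendOpt bm a j, extendOpt bp a' j)

lemma some_ne_extendOpt_iff {ι κ : Type*} [DecidableEq ι] {s : Finset ι} (a : s → κ) (i : ι)
    (b : κ) : some b ≠ extendOpt s a i ↔ ∀ k : s, (k : ι) = i → b ≠ a k := by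
  constructor
  · rintro h k rfl rfl
    exact h (extendOpt_of_mem a k).symm
  · intro h hb
    by_cases hi : i ∈ s
    · rw [extendOpt_of_mem a ⟨i, hi⟩] at hb
      exact h ⟨i, hi⟩ rfl (Option.some.inj hb)
    · rw [extendOpt_of_notMem a hi] at hb
      exact Option.some_ne_none _ hb

lemma remaining_history (a : bm → Fin (R + m)) (a' : bp → Fin (R + m)) (t : ℕ) :
    remaining (history a a') t = setA a a' t := by
  ext b
  simp only [remaining, history, setA, Finset.mem_filter, Finset.mem_univ, true_and,
    some_ne_extendOpt_iff]
  constructor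
  · intro h
    exact ⟨fun k hk => (h k hk).1 k rfl, fun k hk => (h k hk).2 k rfl⟩
  · rintro ⟨h1, h2⟩ k hk
    exact ⟨fun i hi => h1 i (hi ▸ hk), fun i hi => h2 i (hi ▸ hk)⟩

lemma eraseOpt_setA (a : bm → Fin (R + m)) (a' : bp → Fin (R + m)) (j : Fin m) :
    eraseOpt (setA a a' j) (extendOpt bm a j) = setA' a a' j := by
  ext b
  simp only [eraseOpt, setA, setA', Finset.mem_filter, Finset.mem_univ, true_and,
    some_ne_extendOpt_iff]
  constructor
  · rintro ⟨⟨h1, h2⟩, h3⟩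
    refine ⟨fun k hk => ?_, h2⟩
    rcases hk.lt_or_eq with h | h
    · exact h1 k h
    · exact h3 k (Fin.ext h)
  · rintro ⟨h1, h2⟩
    exact ⟨⟨fun k hk => h1 k hk.le, h2⟩, fun k hk => h1 k (by rw [hk])⟩

lemma eraseOpt_setA' (a : bm → Fin (R + m)) (a' : bp → Fin (R + m)) (j : Fin m) :
    eraseOpt (setA' a a' j) (extendOpt bp a' j) = setA a a' (j + 1) := by
  ext b
  simp only [eraseOpt, setA, setA', Finset.mem_filter, Finset.mem_univ, true_and,
    some_ne_extendOpt_iff, Nat.lt_succ_iff]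
  constructor
  · rintro ⟨⟨h1, h2⟩, h3⟩
    refine ⟨h1, fun k hk => ?_⟩
    rcases hk.lt_or_eq with h | h
    · exact h2 k h
    · exact h3 k (Fin.ext h)
  · rintro ⟨h1, h2⟩
    exact ⟨⟨h1, fun k hk => h2 k hk.le⟩, fun k hk => h2 k (by rw [hk])⟩

variable {N : ℕ} {η : ℂ} {ξ : Fin N → ℂ} {q : Fin (R + m) → ℂ}

lemma coeffStep_history (e : Fin 2 × Fin 2) (a : bm → Fin (R + m)) (a' : bp → Fin (R + m))
    (j : Fin m) : coeffStep η ξ q e j (remaining (history a a') j) (history a a' j) =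
      (-1) ^ N * coeffMinus η ξ q e.1 j (setA a a' j) (extendOpt bm a j) *
        coeffPlus η ξ q e.2 j (setA' a a' j) (extendOpt bp a' j) := by
  rw [coeffStep, remaining_history, ← eraseOpt_setA]
  rfl

lemma prod_coeffStep_eq_zero {ε : Fin m → Fin 2 × Fin 2} {a : bm → Fin (R + m)}
    {a' : bp → Fin (R + m)} (h : ¬ (bm ⊆ alphaMinus ε ∧ bp ⊆ alphaPlus ε ∧
      (a, a') ∈ indexChoices R bm bp)) :
    ∏ j : Fin m, coeffStep η ξ q (ε j) j (remaining (history a a') j) (history a a' j) = 0 := by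
  by_contra hne
  replace hne := Finset.prod_ne_zero_iff.1 hne
  simp only [coeffStep_history] at hne
  have h1 : ∀ j : bm, (ε j).1 = 0 ∧ (a j).val < R + (j.val.val + 1) ∧ a j ∈ setA a a' j.val := by
    intro j
    have hj := right_ne_zero_of_mul (left_ne_zero_of_mul (hne j (Finset.mem_univ _)))
    rw [extendOpt_of_mem] at hj
    by_contra hc
    exact hj (if_neg hc)
  have h2 : ∀ j : bp, (ε j).2 = 1 ∧ (a' j).val < R + (j.val.val + 1) ∧
      a' j ∈ setA' a a' j.val := by
    intro j
    have hj := right_ne_zero_of_mul (hne j (Finset.mem_univ _))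
    rw [extendOpt_of_mem] at hj
    by_contra hc
    exact hj (if_neg hc)
  refine h ⟨fun j hj => ?_, fun j hj => ?_, ?_⟩
  · simpa [alphaMinus] using (h1 ⟨j, hj⟩).1
  · simpa [alphaPlus] using (h2 ⟨j, hj⟩).1
  · simpa [indexChoices] using ⟨fun j hj => (h1 ⟨j, hj⟩).2, fun j hj => (h2 ⟨j, hj⟩).2⟩

lemma prod_eq_prod_coe_mul_prod_compl (s : Finset (Fin m)) (f : Fin m → ℂ) :
    ∏ j, f j = (∏ j : s, f j) * ∏ j ∈ sᶜ, f j := by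
  rw [← Finset.prod_mul_prod_compl s, Finset.prod_coe_sort]

lemma prod_coeffStep {ε : Fin m → Fin 2 × Fin 2} (hbm : bm ⊆ alphaMinus ε)
    (hbp : bp ⊆ alphaPlus ε) {a : bm → Fin (R + m)} {a' : bp → Fin (R + m)}
    (hc : (a, a') ∈ indexChoices R bm bp) :
    ∏ j : Fin m, coeffStep η ξ q (ε j) j (remaining (history a a') j) (history a a' j) =
      (-1 : ℂ) ^ (((m : ℤ) - bm.card + bp.card) * N) *
        (-1 : ℂ) ^ ((alphaMinus ε).card - bm.card : ℤ) *
        ((∏ j : bm, weightMinus η ξ q a a' j) * ∏ j : bp, weightPlus η ξ q a a' j) := by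
  obtain ⟨h1, h2⟩ : (∀ j : bm, (a j).val < R + ((j : Fin m).val + 1) ∧
      a j ∈ setA a a' (j : Fin m).val) ∧ (∀ j : bp, (a' j).val < R + ((j : Fin m).val + 1) ∧
      a' j ∈ setA' a a' (j : Fin m).val) := (Finset.mem_filter.1 hc).2
  have hM : ∏ j : Fin m, coeffMinus η ξ q (ε j).1 j (setA a a' j) (extendOpt bm a j) =
      ((-1) ^ N) ^ bm.card * (∏ j : bm, weightMinus η ξ q a a' j) *
        (-1) ^ (alphaMinus ε \ bm).card := by
    rw [prod_eq_prod_coe_mul_prod_compl bm]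
    congr 1
    · have : ∀ j : bm, coeffMinus η ξ q (ε j).1 j (setA a a' j.val) (extendOpt bm a j) =
          (-1) ^ N * weightMinus η ξ q a a' j := fun j => by
        have he : (ε j).1 = 0 := by simpa [alphaMinus] using hbm j.2
        rw [extendOpt_of_mem]
        simp only [coeffMinus]
        rw [if_pos ⟨he, h1 j⟩, weightMinus, ← eraseOpt_setA, extendOpt_of_mem]
      rw [Finset.prod_congr rfl fun j _ => this j, Finset.prod_mul_distrib, Finset.prod_const,
        Finset.card_univ, Fintype.card_coe]
    · have hsub : alphaMinus ε \ bm ⊆ bmᶜ := fun j hj => by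
        simpa using (Finset.mem_sdiff.1 hj).2
      rw [← Finset.prod_subset hsub]
      · rw [← Finset.prod_const]
        refine Finset.prod_congr rfl fun j hj => ?_
        rw [Finset.mem_sdiff] at hj
        rw [extendOpt_of_notMem a hj.2]
        exact if_pos (by simpa [alphaMinus] using hj.1)
      · intro j hj hj'
        rw [Finset.mem_compl] at hj
        rw [extendOpt_of_notMem a hj]
        exact if_neg fun he => hj' (Finset.mem_sdiff.2 ⟨by simpa [alphaMinus] using he, hj⟩)
  have hP : ∏ j : Fin m, coeffPlus η ξ q (ε j).2 j (setA' a a' j) (extendOpt bp a' j) =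
      ((-1) ^ N) ^ bp.card * ∏ j : bp, weightPlus η ξ q a a' j := by
    rw [prod_eq_prod_coe_mul_prod_compl bp, Finset.prod_eq_one (s := bpᶜ), mul_one]
    · have : ∀ j : bp, coeffPlus η ξ q (ε j).2 j (setA' a a' j.val) (extendOpt bp a' j) =
          (-1) ^ N * weightPlus η ξ q a a' j := fun j => by
        have he : (ε j).2 = 1 := by simpa [alphaPlus] using hbp j.2
        rw [extendOpt_of_mem]
        simp only [coeffPlus]
        rw [if_pos ⟨he, h2 j⟩, weightPlus, ← eraseOpt_setA', extendOpt_of_mem]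
      rw [Finset.prod_congr rfl fun j _ => this j, Finset.prod_mul_distrib, Finset.prod_const,
        Finset.card_univ, Fintype.card_coe]
    · intro j hj
      rw [Finset.mem_compl] at hj
      rw [extendOpt_of_notMem a' hj]
      rfl
  have hs1 : (-1 : ℂ) ^ (((m : ℤ) - bm.card + bp.card) * N) =
      ((-1) ^ N) ^ m * ((-1) ^ N) ^ bm.card * ((-1) ^ N) ^ bp.card := by
    have hu : ((-1 : ℂ) ^ N) ≠ 0 := pow_ne_zero _ (by norm_num)
    rw [_root_.zpow_mul', zpow_natCast, zpow_add₀ hu, zpow_sub₀ hu, zpow_natCast, zpow_natCast,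
      zpow_natCast]
    congr 1
    rw [div_eq_iff (pow_ne_zero _ hu), mul_assoc, ← mul_pow, neg_one_pow_mul_self, one_pow,
      mul_one]
  have hs2 : (-1 : ℂ) ^ ((alphaMinus ε).card - bm.card : ℤ) =
      (-1) ^ (alphaMinus ε \ bm).card := by
    rw [Finset.card_sdiff_of_subset hbm, ← zpow_natCast, Nat.cast_sub (Finset.card_le_card hbm)]
  simp only [coeffStep_history]
  rw [Finset.prod_mul_distrib, Finset.prod_mul_distrib, Finset.prod_const, Finset.card_univ,
    Fintype.card_fin, hM, hP, hs1, hs2]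
  ring

/-- The sum over histories, sorted by the times at which choices are made. -/
lemma sum_histories_eq (ε : Fin m → Fin 2 × Fin 2) (F : Finset (Fin (R + m)) → ℂ) :
    ∑ c : Fin m → Option (Fin (R + m)) × Option (Fin (R + m)),
        (∏ j : Fin m, coeffStep η ξ q (ε j) j (remaining c j) (c j)) * F (remaining c m) =
      ∑ bm ∈ (alphaMinus ε).powerset, ∑ bp ∈ (alphaPlus ε).powerset,
        (-1 : ℂ) ^ (((m : ℤ) - bm.card + bp.card) * N) *
        (-1 : ℂ) ^ ((alphaMinus ε).card - bm.card : ℤ) *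
        ∑ c ∈ indexChoices R bm bp,
          (∏ j : bm, weightMinus η ξ q c.1 c.2 j) * (∏ j : bp, weightPlus η ξ q c.1 c.2 j) *
            F (setA c.1 c.2 m) := by
  have hterm : ∀ bm bp : Finset (Fin m), ∑ a : bm → Fin (R + m), ∑ a' : bp → Fin (R + m),
      (∏ j : Fin m, coeffStep η ξ q (ε j) j (remaining (history a a') j) (history a a' j)) *
        F (remaining (history a a') m) =
      if bm ⊆ alphaMinus ε ∧ bp ⊆ alphaPlus ε then
        (-1 : ℂ) ^ (((m : ℤ) - bm.card + bp.card) * N) *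
        (-1 : ℂ) ^ ((alphaMinus ε).card - bm.card : ℤ) *
        ∑ c ∈ indexChoices R bm bp,
          (∏ j : bm, weightMinus η ξ q c.1 c.2 j) * (∏ j : bp, weightPlus η ξ q c.1 c.2 j) *
            F (setA c.1 c.2 m) else 0 := by
    intro bm bp
    split_ifs with h
    · rw [← Fintype.sum_prod_type' (fun (a : bm → Fin (R + m)) (a' : bp → Fin (R + m)) =>
        (∏ j : Fin m, coeffStep η ξ q (ε j) j (remaining (history a a') j) (history a a' j)) *
        F (remaining (history a a') m)), Finset.mul_sum,
        ← Finset.sum_subset (Finset.subset_univ (indexChoices R bm bp))]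
      · refine Finset.sum_congr rfl fun c hc => ?_
        rw [prod_coeffStep h.1 h.2 hc, remaining_history]
        ring
      · intro c _ hc
        rw [prod_coeffStep_eq_zero fun h' => hc h'.2.2, zero_mul]
    · refine Finset.sum_eq_zero fun a _ => Finset.sum_eq_zero fun a' _ => ?_
      rw [prod_coeffStep_eq_zero fun h' => h ⟨h'.1, h'.2.1⟩, zero_mul]
  rw [← (Equiv.arrowProdEquivProdArrow (Fin m) (fun _ => Option (Fin (R + m)))
    (fun _ => Option (Fin (R + m)))).symm.sum_comp, Fintype.sum_prod_type, sum_option_fun]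
  simp only [sum_option_fun (ι := Fin m) (κ := Fin (R + m))]
  rw [← Finset.sum_subset (Finset.subset_univ (alphaMinus ε).powerset)]
  · refine Finset.sum_congr rfl fun bm hbm => ?_
    rw [Finset.sum_comm, ← Finset.sum_subset (Finset.subset_univ (alphaPlus ε).powerset)]
    · refine Finset.sum_congr rfl fun bp hbp => ?_
      exact (hterm bm bp).trans
        (if_pos ⟨Finset.mem_powerset.1 hbm, Finset.mem_powerset.1 hbp⟩)
    · intro bp _ hbp
      exact (hterm bm bp).trans (if_neg fun h => hbp (Finset.mem_powerset.2 h.2))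
  · intro bm _ hbm
    rw [Finset.sum_comm]
    refine Finset.sum_eq_zero fun bp _ => ?_
    exact (hterm bm bp).trans (if_neg fun h => hbm (Finset.mem_powerset.2 h.1))

lemma card_setA {c : (bm → Fin (R + m)) × (bp → Fin (R + m))} (hc : c ∈ indexChoices R bm bp) :
    ((setA c.1 c.2 m).card : ℤ) = R + m - bm.card - bp.card := by
  obtain ⟨h1, h2⟩ := (Finset.mem_filter.1 hc).2
  have m1 : ∀ j, _ := fun j => (Finset.mem_filter.1 (h1 j).2).2
  have m2 : ∀ j, _ := fun j => (Finset.mem_filter.1 (h2 j).2).2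
  have i1 : Function.Injective c.1 := by
    intro j k h
    by_contra hne
    have hv : j.val.val ≠ k.val.val := fun e => hne (Subtype.ext (Fin.ext e))
    rcases lt_or_gt_of_ne hv with hlt | hlt
    · exact (m1 k).1 j hlt h.symm
    · exact (m1 j).1 k hlt h
  have i2 : Function.Injective c.2 := by
    intro j k h
    by_contra hne
    have hv : j.val.val ≠ k.val.val := fun e => hne (Subtype.ext (Fin.ext e))
    rcases lt_or_gt_of_ne hv with hlt | hlt
    · exact (m2 k).2 j hlt h.symm
    · exact (m2 j).2 k hlt h
  have hdisj : Disjoint (Finset.univ.image c.1) (Finset.univ.image c.2) := by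
    rw [Finset.disjoint_left]
    simp only [Finset.mem_image, Finset.mem_univ, true_and]
    rintro _ ⟨j, rfl⟩ ⟨k, hk⟩
    rcases le_or_gt j.val.val k.val.val with hle | hlt
    · exact (m2 k).1 j hle hk
    · exact (m1 j).2 k hlt hk.symm
  have hset : setA c.1 c.2 m = (Finset.univ.image c.1 ∪ Finset.univ.image c.2)ᶜ := by
    ext b
    simp only [setA, Finset.mem_filter, Finset.mem_univ, true_and, Finset.mem_compl,
      Finset.mem_union, Finset.mem_image, not_or, not_exists, Fin.is_lt, true_implies]
    exact and_congr (forall_congr' fun _ => ne_comm) (forall_congr' fun _ => ne_comm)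
  have hcard := Finset.card_add_card_compl (Finset.univ.image c.1 ∪ Finset.univ.image c.2)
  rw [Finset.card_union_of_disjoint hdisj, Finset.card_image_of_injective _ i1,
    Finset.card_image_of_injective _ i2, ← hset, Finset.card_univ, Finset.card_univ,
    Fintype.card_coe, Fintype.card_coe, Fintype.card_fin] at hcard
  push_cast [← Nat.cast_inj (R := ℤ)] at hcard
  linarith

lemma params_natAdd (hm : m ≤ N) (lam : Fin R → ℂ) (j : Fin m) :
    params hm ξ lam (Fin.natAdd R j) = ξ (Fin.castLE hm j) := by
  simp [params]

lemma params_injective (hm : m ≤ N) {lam : Fin R → ℂ} (hξ : Function.Injective ξ)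
    (hlam : Function.Injective lam) (hne : ∀ i n, lam i ≠ ξ n) :
    Function.Injective (params hm ξ lam) := by
  intro i j
  refine Fin.addCases (fun i => ?_) (fun i => ?_) i <;>
    refine Fin.addCases (fun j => ?_) (fun j => ?_) j <;>
      simp only [params, Fin.append_left, Fin.append_right] <;> intro h
  · rw [hlam h]
  · exact absurd h (hne _ _)
  · exact absurd h.symm (hne _ _)
  · rw [Fin.castLE_injective hm (hξ h)]

lemma rootPoly_params (hm : m ≤ N) (lam : Fin R → ℂ) :
    rootPoly (Finset.univ.filter fun k : Fin (R + m) => k.val < R + 0) (params hm ξ lam) =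
      rootPoly Finset.univ lam := by
  rw [rootPoly, Finset.prod_filter, Fin.prod_univ_add]
  simp [rootPoly, params]

end

end

end AntiperiodicXXX

theorem mainTheorem4 (N m R : ℕ) (hm : m ≤ N) (hR : R ≤ N)
    (η : ℂ) (hη : η ≠ 0)
    (ξ : Fin N → ℂ)
    (hξ : ∀ i j, i ≠ j → ξ i ≠ ξ j ∧ ξ i ≠ ξ j + η ∧ ξ i ≠ ξ j - η)
    (lam : Fin R → ℂ) (hlam : Function.Injective lam)
    (hlamξ : ∀ i n, lam i ≠ ξ n)
    (Q : Polynomial ℂ) (hQ : Q = AntiperiodicXXX.rootPoly Finset.univ lam)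
    (τ : ℂ → ℂ) (hτ : Differentiable ℂ τ)
    (hTQ : ∀ z, τ z * Q.eval z =
      -(AntiperiodicXXX.aFun η ξ z * Q.eval (z - η)) +
        AntiperiodicXXX.dFun ξ z * Q.eval (z + η))
    (ε : Fin m → Fin 2 × Fin 2)
    (q : Fin (R + m) → ℂ) (hq : q = AntiperiodicXXX.params hm ξ lam) :
    AntiperiodicXXX.elementaryBlock η ξ hm Q ε =
      (∏ k : Fin m, 1 / τ (ξ (Fin.castLE hm k))) *
        ∑ bm ∈ (AntiperiodicXXX.alphaMinus ε).powerset,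
          ∑ bp ∈ (AntiperiodicXXX.alphaPlus ε).powerset,
            (-1 : ℂ) ^ (((m : ℤ) - bm.card + bp.card) * N) *
            (-1 : ℂ) ^ ((AntiperiodicXXX.alphaMinus ε).card - bm.card : ℤ) *
            ∑ c ∈ AntiperiodicXXX.indexChoices R bm bp,
              (∏ j : bm, AntiperiodicXXX.weightMinus η ξ q c.1 c.2 j) *
              (∏ j : bp, AntiperiodicXXX.weightPlus η ξ q c.1 c.2 j) *
              (AntiperiodicXXX.sepPairing η ξ
                  (AntiperiodicXXX.rootPoly (AntiperiodicXXX.setA c.1 c.2 m) q) Q /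
                AntiperiodicXXX.sepPairing η ξ Q Q)
    ∧ ∀ bm ⊆ AntiperiodicXXX.alphaMinus ε, ∀ bp ⊆ AntiperiodicXXX.alphaPlus ε,
        ∀ c ∈ AntiperiodicXXX.indexChoices R bm bp,
          (AntiperiodicXXX.rootPoly (AntiperiodicXXX.setA c.1 c.2 m) q).natDegree =
              (AntiperiodicXXX.setA c.1 c.2 m).card ∧
          ((AntiperiodicXXX.setA c.1 c.2 m).card : ℤ) = R + m - bm.card - bp.card := by
  have hg : AntiperiodicXXX.Generic η ξ := ⟨hη, hξ⟩
  subst hQ hq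
  have hξi : Function.Injective ξ := fun i j h => by
    by_contra hne
    exact (hξ i j hne).1 h
  have hqi := AntiperiodicXXX.params_injective hm hξi hlam hlamξ
  have hτp := AntiperiodicXXX.isPolyLT_of_functional_equation hlam hτ.continuous hTQ
  have hT := AntiperiodicXXX.chain_isSoVRep (ξ := ξ) hη
    (List.nodup_reverse.2 (List.nodup_finRange N)) (fun n => by simp)
  refine ⟨?_, fun bm _ bp _ c hc =>
    ⟨AntiperiodicXXX.natDegree_rootPoly _ _, AntiperiodicXXX.card_setA hc⟩⟩
  have hτ0 : ∏ k : Fin m, τ (ξ (Fin.castLE hm k)) ≠ 0 :=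
    Finset.prod_ne_zero_iff.2 fun k _ => AntiperiodicXXX.eigenvalue_ne_zero hg hTQ (by
      rw [AntiperiodicXXX.eval_rootPoly]
      exact Finset.prod_ne_zero_iff.2 fun i _ => sub_ne_zero.2 (hlamξ i _).symm)
  have h1 := AntiperiodicXXX.sepBra_elemAt_sepKet hg hτp hTQ hm ε
  have h2 := AntiperiodicXXX.sepOf_mul_prod hg hT hqi
    (AntiperiodicXXX.params_natAdd (ξ := ξ) hm lam) ε
  rw [AntiperiodicXXX.sepOf, AntiperiodicXXX.rootPoly_params hm lam] at h2
  rw [AntiperiodicXXX.sepBra_eq_sep (AntiperiodicXXX.rootPoly Finset.univ lam), h2,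
    sum_dotProduct] at h1
  have h3 : ∀ A : Finset (Fin (R + m)),
      AntiperiodicXXX.sepOf η ξ (AntiperiodicXXX.chain η ξ (List.finRange N).reverse)
        (AntiperiodicXXX.params hm ξ lam) m A =
      AntiperiodicXXX.sepBra η ξ
        (AntiperiodicXXX.rootPoly A (AntiperiodicXXX.params hm ξ lam)) := by
    intro A
    rw [AntiperiodicXXX.sepBra_eq_sep, AntiperiodicXXX.sepOf, Finset.filter_true_of_mem]
    exact fun k _ => k.2
  simp only [h3, smul_dotProduct, smul_eq_mul] at h1
  rw [← AntiperiodicXXX.sum_histories_eq ε (fun A => AntiperiodicXXX.sepPairing η ξ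
    (AntiperiodicXXX.rootPoly A (AntiperiodicXXX.params hm ξ lam))
      (AntiperiodicXXX.rootPoly Finset.univ lam) /
    AntiperiodicXXX.sepPairing η ξ (AntiperiodicXXX.rootPoly Finset.univ lam)
      (AntiperiodicXXX.rootPoly Finset.univ lam))]
  simp only [← mul_div_assoc, ← Finset.sum_div, Finset.prod_div_distrib, Finset.prod_const_one]
  rw [AntiperiodicXXX.elementaryBlock, AntiperiodicXXX.sepBra_eq_sep (AntiperiodicXXX.rootPoly
    Finset.univ lam)]
  congr 1
  simp only [AntiperiodicXXX.sepPairing]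
  rw [← h1, one_div, inv_mul_cancel_left₀ hτ0]
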